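/- Let $n\ge 1$ and let $Y$ be a smooth (Hausdorff, second countable) manifold of dimension $n+1$ with (possibly empty) boundary $\partial Y$. Let $\mathcal A_Y$ be the set of $n$-dimensional embedded submanifolds with boundary $L\subseteq Y$ that are connected, compact and oriented, satisfy $\partial L=L\cap\partial Y$, and are nowhere tangent to $\partial Y$. Let $\lambda$ be a smooth Lagrangian of order $r\ge 0$, i.e. a smooth horizontal $n$-form on the Grassmann fibration $G^r_nY$ of $r$-jets of $n$-dimensional submanifolds of $Y$; in a smooth chart $(\boldsymbol x,u)=(x^1,\dots,x^n,u)$ of $Y$ it reads $\lambda=\mathcal L(\boldsymbol x,(u_I)_{|I|\le r})\,d^n\boldsymbol x$, where $I=(i_1,\dots,i_n)$ is a multi-index. All charts near boundary points are taken with $Y=\{x^n\ge 0\}$ and $\partial Y=\{x^n=0\}$. Put $\mathcal S_\lambda[L]=\int_L (j^rL)^*\lambda$ for $L\in\mathcal A_Y$. Suppose that $L\in\mathcal A_Y$ solves the variational problem with free boundary values determined by $\lambda$, i.e. $L$ is critical for $\mathcal S_\lambda$ on $\mathcal A_Y$: $\frac{d}{dt}\big|_{t=0}\mathcal S_\lambda[\Phi_t(L)]=0$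 for every smooth one-parameter family $\Phi_t$ ($t\in\mathbb R$) of diffeomorphisms of the manifold with boundary $Y$ with $\Phi_0=\mathrm{id}$ (each $\Phi_t$ preserves $\partial Y$, so that $\Phi_t(L)\in\mathcal A_Y$). Then: 1. The Euler–Lagrange equations $\boldsymbol E_Y(\lambda)=0$ hold on $L$: in every smooth chart $(\boldsymbol x,u)$ of $Y$ in which $L$ is locally the graph of a smooth function $u=u(\boldsymbol x)$, $$\sum_{|I|\le r}(-1)^{|I|}\frac{d^{|I|}}{d\boldsymbol x^I}\Big(\frac{\partial\mathcal L}{\partial u_I}\Big)=0$$ at all points of that piece of $L$ (boundary points included), all functions being evaluated along the $r$-jet of $u=u(\boldsymbol x)$. 2. The natural boundary conditions $\boldsymbol E^\partial_Y(\lambda)=0$ hold on $\partial L$: in every such chart, at all points of $\partial L=L\cap\{x^n=0\}$ in that piece, $$\sum_{|I|\le r,\ i_n>\alpha}(-1)^{|I|-\alpha-1}\frac{d^{|I|-i_n}}{d\boldsymbol x^{I-i_n}}\left(\left.\frac{d^{\,i_n-\alpha-1}}{d(x^n)^{i_n-\alpha-1}}\Big(\frac{\partial\mathcal L}{\partial u_I}\Big)\right|_{x^n=0}\right)=0,\qquad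 \alpha=0,\dots,r-1,$$ where $I-i_n=(i_1,\dots,i_{n-1},0)$. -/

import Mathlib

open Set Filter Topology MeasureTheory Manifold
open scoped ContDiff

noncomputable section

namespace FreeBoundary

/-- Points of `ℝⁿ`. -/
abbrev E (n : ℕ) : Type := EuclideanSpace ℝ (Fin n)

/-- The closed half-space `{x ∈ ℝⁿ | 0 ≤ x₀}`. The distinguished coordinate, whose vanishing
describes the boundary, is the one with index `0`. -/
def halfSpace (n : ℕ) [NeZero n] : Set (E n) := {x | 0 ≤ x 0}

/-- The point `(x, v)` of `ℝⁿ⁺¹`: the first `n` coordinates are the independent variables `x`,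
the last one is the dependent variable `u = v`. -/
def withLast {n : ℕ} (x : E n) (v : ℝ) : E (n + 1) :=
  WithLp.toLp 2 (Fin.snoc (α := fun _ => ℝ) (fun i => x i) v)

/-- The projection `(x, u) ↦ x`. -/
def dropLast {n : ℕ} (z : E (n + 1)) : E n := WithLp.toLp 2 (fun i => z i.castSucc)

/-- The partial derivative `∂g/∂xᵢ` of a function on the half-space (one-sided in the direction of
`x₀` at points with `x₀ = 0`). -/
def partialD {n : ℕ} [NeZero n] (i : Fin n) (g : E n → ℝ) : E n → ℝ :=
  fun x => fderivWithin ℝ g (halfSpace n) x (EuclideanSpace.single i 1)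

/-- The iterated partial derivative `∂^J g`; the derivatives with respect to `x₀` are taken
first, those with respect to `x₁, …, xₙ₋₁` afterwards. -/
def iterD {n : ℕ} [NeZero n] (J : Fin n → ℕ) (g : E n → ℝ) : E n → ℝ :=
  (List.finRange n).foldl (fun h i => (partialD i)^[J i] h) g

/-- Multi-indices `I = (i₀, …, iₙ₋₁)` of length `|I| ≤ r`. -/
abbrev MultiIndex (n r : ℕ) : Type := {I : Fin n → Fin (r + 1) // ∑ i, (I i : ℕ) ≤ r}

namespace MultiIndex

/-- The entries of a multi-index as natural numbers. -/
def entries {n r : ℕ} (I : MultiIndex n r) : Fin n → ℕ := fun i => (I.1 i : ℕ)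

/-- The length `|I|`. -/
def length {n r : ℕ} (I : MultiIndex n r) : ℕ := ∑ i, I.entries i

/-- The multi-index `(0, …, 0)`, so that `u_0 = u`. -/
def zero (n r : ℕ) : MultiIndex n r := ⟨fun _ => 0, by simp⟩

end MultiIndex

/-- The space with coordinates `(x, (u_I)_{|I| ≤ r})`, i.e. the range of the coordinates that a
chart `(x, u)` of `Y` induces on the `r`-th order Grassmann fibration of `Y`. -/
abbrev Jet (n r : ℕ) : Type := E n × (MultiIndex n r → ℝ)

/-- The coordinates `(x, (∂^I f(x))_{|I| ≤ r})` of the `r`-jet at `x` of the graph of `f`. -/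
def jet {n : ℕ} [NeZero n] (r : ℕ) (f : E n → ℝ) (x : E n) : Jet n r :=
  (x, fun I => iterD I.entries f x)

variable {n : ℕ} [NeZero n] {Y : Type*} [TopologicalSpace Y]

/-- The point of `Y` with coordinates `(x, f x)` in the chart `e`. -/
def graphPt (e : OpenPartialHomeomorph Y (EuclideanHalfSpace (n + 1))) (f : E n → ℝ) (x : E n) :
    Y :=
  (e.extend (𝓡∂ (n + 1))).symm (withLast x (f x))

/-- For two charts `e = (x, u)` and `e' = (x', u')`: the expression of the functions `x'` along the
graph `u = f(x)` in terms of the coordinates `x`. -/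
def transition (e : OpenPartialHomeomorph Y (EuclideanHalfSpace (n + 1))) (f : E n → ℝ)
    (e' : OpenPartialHomeomorph Y (EuclideanHalfSpace (n + 1))) : E n → E n :=
  fun x => dropLast (e'.extend (𝓡∂ (n + 1)) (graphPt e f x))

/-- The Jacobian determinant `det (∂x'/∂x)` of the change of independent variables along the graph
`u = f(x)`. -/
def jacobian (e : OpenPartialHomeomorph Y (EuclideanHalfSpace (n + 1))) (f : E n → ℝ)
    (e' : OpenPartialHomeomorph Y (EuclideanHalfSpace (n + 1))) (x : E n) : ℝ :=
  (fderivWithin ℝ (transition e f e') (halfSpace n) x).det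

variable [ChartedSpace (EuclideanHalfSpace (n + 1)) Y]

/-- In the smooth chart `e = (x, u)` of `Y`, an open piece of the set `S` is the graph `u = f(x)` of
the smooth function `f` on `Ω`, where `Ω` is open in the half-space `x₀ ≥ 0`. -/
structure IsGraphOn (S : Set Y) (e : OpenPartialHomeomorph Y (EuclideanHalfSpace (n + 1)))
    (f : E n → ℝ) (Ω : Set (E n)) : Prop where
  chart_mem : e ∈ IsManifold.maximalAtlas (𝓡∂ (n + 1)) ∞ Y
  isOpen_domain : ∃ O : Set (E n), IsOpen O ∧ Ω = O ∩ halfSpace n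
  smooth : ContDiffOn ℝ ∞ f Ω
  mem_target : ∀ x ∈ Ω, withLast x (f x) ∈ (e.extend (𝓡∂ (n + 1))).target
  isOpen_image : ∃ V : Set Y, IsOpen V ∧ graphPt e f '' Ω = S ∩ V

/-- An `r`-th order Lagrangian on `Y`: a smooth horizontal `n`-form `λ` on the `r`-th order
Grassmann fibration of `n`-dimensional submanifolds of `Y`. It is given by its local expressions
`λ = 𝓛_e(x, u_I) dx` in the charts `e = (x, u)` of `Y`. The coefficients are smooth, and they change
as the coefficients of an `n`-form: if two graphs describe the same submanifold near
a point, then `𝓛_e = 𝓛_{e'} · det (∂x'/∂x)` at the jet of that submanifold. -/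
structure Lagrangian (n : ℕ) [NeZero n] (Y : Type*) [TopologicalSpace Y]
    [ChartedSpace (EuclideanHalfSpace (n + 1)) Y] (r : ℕ) where
  /-- the local expression `𝓛_e` -/
  coeff : OpenPartialHomeomorph Y (EuclideanHalfSpace (n + 1)) → Jet n r → ℝ
  smooth : ∀ e ∈ IsManifold.maximalAtlas (𝓡∂ (n + 1)) ∞ Y,
    ContDiffOn ℝ ∞ (coeff e)
      {j | withLast j.1 (j.2 (MultiIndex.zero n r)) ∈ (e.extend (𝓡∂ (n + 1))).target}
  change : ∀ (S : Set Y) (e e' : OpenPartialHomeomorph Y (EuclideanHalfSpace (n + 1)))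
    (f f' : E n → ℝ) (Ω Ω' : Set (E n)), IsGraphOn S e f Ω → IsGraphOn S e' f' Ω' →
    ∀ x ∈ Ω, ∀ x' ∈ Ω', graphPt e f x = graphPt e' f' x' →
      coeff e (jet r f x) = coeff e' (jet r f' x') * jacobian e f e' x

/-- A subset of `Y` with the data of an orientation: for every chart `e = (x, u)` of `Y` and every
point of the set near which the set is a graph `u = f(x)`, the sign tells whether the coordinates
`x` on the set are positively (`1`) or negatively (`-1`) oriented. -/
structure OrientedSet (n : ℕ) [NeZero n] (Y : Type*) [TopologicalSpace Y] where
  carrier : Set Y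
  sign : OpenPartialHomeomorph Y (EuclideanHalfSpace (n + 1)) → Y → ℤˣ

/-- The signs form an orientation: they are locally constant, and the signs of two systems of
coordinates agree or differ according to the sign of the Jacobian determinant. -/
structure IsOrientation (L : OrientedSet n Y) : Prop where
  locally_constant : ∀ e f Ω, IsGraphOn L.carrier e f Ω → ∀ x ∈ Ω,
    ∀ᶠ z in 𝓝[Ω] x, L.sign e (graphPt e f z) = L.sign e (graphPt e f x)
  change : ∀ e e' f f' Ω Ω', IsGraphOn L.carrier e f Ω → IsGraphOn L.carrier e' f' Ω' →
    ∀ x ∈ Ω, ∀ x' ∈ Ω', graphPt e f x = graphPt e' f' x' →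
      0 < ((L.sign e (graphPt e f x) : ℤ) : ℝ) * ((L.sign e' (graphPt e f x) : ℤ) : ℝ)
        * jacobian e f e' x

/-- `S` is an `n`-dimensional (embedded) submanifold with boundary of `Y` whose boundary is
`S ∩ ∂Y`, and which is nowhere tangent to `∂Y`: at the points of `S ∩ ∂Y` the differential of
the boundary coordinate `x₀` of `Y` does not vanish on the tangent space of `S`. -/
def IsNonTangentSubmanifold (S : Set Y) : Prop :=
  ∃ _ : ChartedSpace (EuclideanHalfSpace n) S,
    IsManifold (𝓡∂ n) ∞ S ∧
    IsSmoothEmbedding (𝓡∂ n) (𝓡∂ (n + 1)) ∞ (Subtype.val : S → Y) ∧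
    Subtype.val '' ((𝓡∂ n).boundary S) = S ∩ (𝓡∂ (n + 1)).boundary Y ∧
    ∀ p : S, (p : Y) ∈ (𝓡∂ (n + 1)).boundary Y →
      ∀ e ∈ IsManifold.maximalAtlas (𝓡∂ (n + 1)) ∞ Y, (p : Y) ∈ e.source →
        mfderiv (𝓡∂ n) 𝓘(ℝ, ℝ) (fun q : S => (e.extend (𝓡∂ (n + 1)) (q : Y)) 0) p ≠ 0

/-- The class of admissible submanifolds of `Y`. -/
structure IsAdmissible (L : OrientedSet n Y) : Prop where
  isConnected : IsConnected L.carrier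
  isCompact : IsCompact L.carrier
  isOrientation : IsOrientation L
  isSubmanifold : IsNonTangentSubmanifold (n := n) L.carrier

/-- The image of an oriented set under a diffeomorphism `Φ` of `Y`, with the orientation
transported by `Φ`. -/
def OrientedSet.map (L : OrientedSet n Y)
    (Φ : Diffeomorph (𝓡∂ (n + 1)) (𝓡∂ (n + 1)) Y Y ∞) : OrientedSet n Y where
  carrier := Φ '' L.carrier
  sign e q := L.sign (Φ.toHomeomorph.toOpenPartialHomeomorph.trans e) (Φ.symm q)

/-- `s` is the value `S_λ[L] = ∫_L (j^r L)^* λ` of the action: `L` is covered by finitely many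
graphs `u = fᵢ(x)`, `x ∈ Ωᵢ`, in charts `eᵢ` of `Y`, and, for a subordinate partition of unity `ρᵢ`
on `L`, `s = ∑ᵢ ∫_{Ωᵢ} ± ρᵢ 𝓛_{eᵢ}(x, ∂^I fᵢ(x)) dx`, the signs being those of the orientation. -/
def HasAction {r : ℕ} (lam : Lagrangian n Y r) (L : OrientedSet n Y) (s : ℝ) : Prop :=
  ∃ (N : ℕ) (e : Fin N → OpenPartialHomeomorph Y (EuclideanHalfSpace (n + 1)))
    (f : Fin N → E n → ℝ) (Ω : Fin N → Set (E n)) (ρ : Fin N → Y → ℝ),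
    (∀ i, IsGraphOn L.carrier (e i) (f i) (Ω i)) ∧
    (∀ i, ContinuousOn (ρ i) L.carrier) ∧
    (∀ i, ∃ K : Set (E n), IsCompact K ∧ K ⊆ Ω i ∧
      ∀ p ∈ L.carrier, ρ i p ≠ 0 → p ∈ graphPt (e i) (f i) '' K) ∧
    (∀ p ∈ L.carrier, ∑ i, ρ i p = 1) ∧
    s = ∑ i, ∫ x in Ω i, ρ i (graphPt (e i) (f i) x)
      * ((L.sign (e i) (graphPt (e i) (f i) x) : ℤ) : ℝ) * lam.coeff (e i) (jet r (f i) x)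

/-- `L` is critical for the action: the derivative of `S_λ[Φ_t(L)]` at `t = 0` is zero for
every smooth one-parameter family `Φ_t` of diffeomorphisms of the manifold with boundary `Y` with
`Φ_0 = id`. Diffeomorphisms of `Y` preserve `∂Y`, so `Φ_t(L)` is a curve of admissible submanifolds,
and its boundary moves freely in `∂Y`. -/
def IsCritical {r : ℕ} (lam : Lagrangian n Y r) (L : OrientedSet n Y) : Prop :=
  ∀ Φ : ℝ → Diffeomorph (𝓡∂ (n + 1)) (𝓡∂ (n + 1)) Y Y ∞,
    ContMDiff (𝓘(ℝ, ℝ).prod (𝓡∂ (n + 1))) (𝓡∂ (n + 1)) ∞ (fun q : ℝ × Y => Φ q.1 q.2) →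
    (∀ p, Φ 0 p = p) →
    ∀ s : ℝ → ℝ, (∀ t, HasAction lam (L.map (Φ t)) (s t)) → HasDerivAt s 0 0

/-- The function `∂𝓛_e/∂u_I`. -/
def dCoeff {r : ℕ} (lam : Lagrangian n Y r)
    (e : OpenPartialHomeomorph Y (EuclideanHalfSpace (n + 1))) (I : MultiIndex n r) (j : Jet n r) :
    ℝ :=
  fderiv ℝ (fun c => lam.coeff e (j.1, c)) j.2 (Pi.single I 1)

/-- The Euler–Lagrange expression `δ𝓛/δu = ∑_{|I| ≤ r} (-1)^|I| d^|I|/dx^I (∂𝓛/∂u_I)` in the chart `e`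
along the graph of `f`; the total derivatives are the derivatives along the graph. -/
def eulerLagrange {r : ℕ} (lam : Lagrangian n Y r)
    (e : OpenPartialHomeomorph Y (EuclideanHalfSpace (n + 1))) (f : E n → ℝ) (x : E n) : ℝ :=
  ∑ I : MultiIndex n r,
    (-1) ^ I.length * iterD I.entries (fun z => dCoeff lam e I (jet r f z)) x

/-- The component with index `α` of the boundary Euler operator in the chart `e` along the graph
of `f`, at a point `x` with `x₀ = 0`:
`∑_{|I| ≤ r, i₀ > α} (-1)^(|I|-α-1) d^(I-i₀)/dx^(I-i₀) (d^(i₀-α-1)/dx₀^(i₀-α-1) (∂𝓛/∂u_I))`, where `I - i₀` is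
the multi-index `I` with the entry `i₀` replaced by `0`. -/
def boundaryEuler {r : ℕ} (lam : Lagrangian n Y r)
    (e : OpenPartialHomeomorph Y (EuclideanHalfSpace (n + 1))) (f : E n → ℝ) (α : ℕ) (x : E n) : ℝ :=
  ∑ I : MultiIndex n r with α < I.entries 0,
    (-1) ^ (I.length - α - 1) *
      iterD (Function.update I.entries 0 (I.entries 0 - α - 1))
        (fun z => dCoeff lam e I (jet r f z)) x

/-- `E_Y(λ) = 0` holds at the point `p` of the set `S`: the Euler–Lagrange expression vanishes at `p`
in every smooth chart `(x, u)` of `Y` in which `S` is a graph `u = f(x)` near `p`. -/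
def EulerLagrangeAt {r : ℕ} (lam : Lagrangian n Y r) (S : Set Y) (p : Y) : Prop :=
  ∀ e f Ω, IsGraphOn S e f Ω → ∀ x ∈ Ω, graphPt e f x = p → eulerLagrange lam e f x = 0

/-- `E^∂_Y(λ) = 0` holds at the point `p ∈ ∂Y` of the set `S`: all components of the boundary Euler
operator vanish at `p` in every smooth chart `(x, u)` of `Y` (where `∂Y` is `x₀ = 0`) in which `S`
is a graph `u = f(x)` near `p`. -/
def NaturalBoundaryAt {r : ℕ} (lam : Lagrangian n Y r) (S : Set Y) (p : Y) : Prop :=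
  ∀ e f Ω, IsGraphOn S e f Ω → ∀ x ∈ Ω, graphPt e f x = p →
    ∀ α < r, boundaryEuler lam e f α x = 0

end FreeBoundary

end

/-!
The idea is to test criticality only with diffeomorphisms that move a single graph piece of `L` in
the vertical direction, and to integrate by parts in the half-space of the independent variables.

Near a point of a graph `u = f(x)` in `L`, let `φ` be a smooth function with small compact support,
which need not vanish on `x₀ = 0`. Moving points along the last coordinate of the chart preserves
the boundary coordinate `x₀`, hence `∂Y`; cut off by a bump function in `u` this gives a smooth
family of diffeomorphisms of `Y` that carries the graph of `f` to the graphs of `f + (ε sin t) φ`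
and fixes the rest of `L` (`exists_vertical_family`, `exists_graph_variation`). The sine keeps the
displacement small, so that the family is defined for all `t`.

The hypothesis that `L` is critical speaks about curves of values of the action, so the action of
the varied submanifolds must be shown to have a value for every `t`. This is where the submanifold
structure of `L` enters: by the normal form of immersions, non-tangency to `∂Y` and the inverse
function theorem, `L` is a graph in some chart near each of its points (`exists_isGraphOn`), and by
compactness it is covered by finitely many graphs, of which only the prescribed one meets the
support of the family (`exists_partition`). The action of the image of `L` is then the sum of the
integrals over the varied graph and over the others, which do not depend on `t`
(`hasAction_map`). Differentiation under the integral sign gives the vanishing of the first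
variation `∑_I ∫ (∂𝓛/∂u_I) ∂^I φ dx` over the half-space (`first_variation_eq_zero`).

Integration by parts in the half-space turns the first variation into
`∫ E φ + ∑_{α < r} ± ∫_{x₀ = 0} B_α ∂₀^α φ`, where `E` is the Euler–Lagrange expression and
the `B_α` are the components of the boundary Euler operator (`sum_integral_mul_iterD`). For the
test functions `φ = x₀^k ψ`, the derivatives `∂₀^α φ` with `α < k` vanish on `x₀ = 0`, and
`∂₀^k φ = k! ψ` there. The choice `k = r` gives `E = 0` for `x₀ > 0` and, by continuity, up to the
boundary; the choices `k < r` then give `B_k = 0`, by downward induction on `k`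
(`euler_of_variation`, `euler_of_local_variation`).
-/

noncomputable section

namespace FreeBoundary

/-! ### Calculus on the half-space -/

section HalfSpace

variable {n : ℕ} [NeZero n]

theorem isClosed_halfSpace : IsClosed (halfSpace n) :=
  isClosed_le continuous_const (by fun_prop)

theorem interior_halfSpace_eq : interior (halfSpace n) = {x | 0 < x 0} :=
  interior_halfSpace 2 0 0

theorem convex_halfSpace : Convex ℝ (halfSpace n) := by
  intro x hx y hy a b ha hb _
  have : (0 : ℝ) ≤ a * x 0 + b * y 0 := add_nonneg (mul_nonneg ha hx) (mul_nonneg hb hy)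
  simpa [halfSpace] using this

theorem nonempty_interior_halfSpace : (interior (halfSpace n)).Nonempty := by
  rw [interior_halfSpace_eq]
  exact ⟨EuclideanSpace.single 0 1, by simp⟩

theorem uniqueDiffOn_halfSpace : UniqueDiffOn ℝ (halfSpace n) :=
  uniqueDiffOn_convex convex_halfSpace nonempty_interior_halfSpace

theorem closure_interior_halfSpace : closure (interior (halfSpace n)) = halfSpace n := by
  rw [convex_halfSpace.closure_interior_eq_closure_of_nonempty_interior
    nonempty_interior_halfSpace, isClosed_halfSpace.closure_eq]

theorem fderivWithin_inter_halfSpace {F : Type*} [NormedAddCommGroup F] [NormedSpace ℝ F]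
    {g : E n → F} {O : Set (E n)} (hO : IsOpen O) {x : E n} (hx : x ∈ O) :
    fderivWithin ℝ g (O ∩ halfSpace n) x = fderivWithin ℝ g (halfSpace n) x := by
  rw [inter_comm]
  exact fderivWithin_inter (hO.mem_nhds hx)

/-- The value is the default of `fderivWithin` off the closed half-space. It lets integrals of
partial derivatives over the half-space be read as integrals over the whole space. -/
theorem partialD_eq_zero_of_notMem (i : Fin n) (g : E n → ℝ) {x : E n} (hx : x ∉ halfSpace n) :
    partialD i g x = 0 := by
  rw [partialD, fderivWithin_zero_of_notMem_closure (by rwa [isClosed_halfSpace.closure_eq])]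
  simp

theorem partialD_congr (i : Fin n) {g g' : E n → ℝ} {O : Set (E n)} (hO : IsOpen O)
    (h : EqOn g g' (O ∩ halfSpace n)) :
    EqOn (partialD i g) (partialD i g') (O ∩ halfSpace n) := by
  intro x hx
  rw [partialD, partialD, ← fderivWithin_inter_halfSpace hO hx.1,
    ← fderivWithin_inter_halfSpace hO hx.1, fderivWithin_congr h (h hx)]

theorem ContDiffOn.partialD {g : E n → ℝ} {O : Set (E n)} (hO : IsOpen O)
    (hg : ContDiffOn ℝ ∞ g (O ∩ halfSpace n)) (i : Fin n) :
    ContDiffOn ℝ ∞ (partialD i g) (O ∩ halfSpace n) := by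
  have hu : UniqueDiffOn ℝ (O ∩ halfSpace n) := by
    rw [inter_comm]; exact uniqueDiffOn_halfSpace.inter hO
  have h1 := (hg.fderivWithin hu (m := ∞) (by simp)).clm_apply
    (contDiffOn_const (c := EuclideanSpace.single i (1 : ℝ)))
  refine h1.congr fun x hx => ?_
  rw [FreeBoundary.partialD, fderivWithin_inter_halfSpace hO hx.1]

theorem differentiableWithinAt_halfSpace {F : Type*} [NormedAddCommGroup F] [NormedSpace ℝ F]
    {g : E n → F} {O : Set (E n)} (hO : IsOpen O)
    (hg : ContDiffOn ℝ ∞ g (O ∩ halfSpace n)) {x : E n} (hx : x ∈ O ∩ halfSpace n) :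
    DifferentiableWithinAt ℝ g (halfSpace n) x := by
  have := (hg.differentiableOn (by simp)) x hx
  rw [inter_comm] at this
  exact (differentiableWithinAt_inter (hO.mem_nhds hx.1)).1 this

theorem partialD_add_const_mul (i : Fin n) {g h : E n → ℝ} {O : Set (E n)} (hO : IsOpen O)
    (hg : ContDiffOn ℝ ∞ g (O ∩ halfSpace n)) (hh : ContDiffOn ℝ ∞ h (O ∩ halfSpace n)) (c : ℝ) :
    EqOn (partialD i (fun x => g x + c * h x)) (fun x => partialD i g x + c * partialD i h x)
      (O ∩ halfSpace n) := by
  intro x hx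
  have h1 := differentiableWithinAt_halfSpace hO hg hx
  have h2 := differentiableWithinAt_halfSpace hO hh hx
  have hu := uniqueDiffOn_halfSpace x hx.2
  simp only [partialD]
  rw [fderivWithin_fun_add hu h1 (h2.const_mul c), fderivWithin_const_mul hu h2]
  simp

theorem partialD_mul (i : Fin n) {g h : E n → ℝ} (hg : ContDiffOn ℝ ∞ g (halfSpace n))
    (hh : ContDiffOn ℝ ∞ h (halfSpace n)) :
    partialD i (fun x => g x * h x) = fun x => partialD i g x * h x + g x * partialD i h x := by
  ext x
  by_cases hx : x ∈ halfSpace n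
  · have h1 := hg.differentiableOn (by simp) x hx
    have h2 := hh.differentiableOn (by simp) x hx
    simp only [partialD]
    rw [fderivWithin_fun_mul (uniqueDiffOn_halfSpace x hx) h1 h2]
    simp; ring
  · simp [partialD_eq_zero_of_notMem _ _ hx]

theorem partialD_comm (i j : Fin n) {g : E n → ℝ} (hg : ContDiffOn ℝ ∞ g (halfSpace n)) :
    partialD i (partialD j g) = partialD j (partialD i g) := by
  ext x
  by_cases hx : x ∈ halfSpace n
  · have hs : IsSymmSndFDerivWithinAt ℝ g (halfSpace n) x :=
      (hg x hx).isSymmSndFDerivWithinAt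
        (by simpa using WithTop.coe_le_coe.2 (le_top : (2 : ℕ∞) ≤ ⊤)) uniqueDiffOn_halfSpace
        (by rwa [closure_interior_halfSpace]) hx
    have hd : DifferentiableWithinAt ℝ (fderivWithin ℝ g (halfSpace n)) (halfSpace n) x :=
      (hg.fderivWithin uniqueDiffOn_halfSpace (m := ∞) (by simp)).differentiableOn (by simp) x hx
    have hk : ∀ k l : Fin n, partialD k (partialD l g) x =
        fderivWithin ℝ (fderivWithin ℝ g (halfSpace n)) (halfSpace n) x
          (EuclideanSpace.single k 1) (EuclideanSpace.single l 1) := by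
      intro k l
      change fderivWithin ℝ (fun y => fderivWithin ℝ g (halfSpace n) y
        (EuclideanSpace.single l 1)) (halfSpace n) x (EuclideanSpace.single k 1) = _
      rw [fderivWithin_clm_apply (uniqueDiffOn_halfSpace x hx) hd (by fun_prop)]
      simp
    rw [hk, hk]
    exact hs _ _
  · simp [partialD_eq_zero_of_notMem _ _ hx]

/-- The iterated partial derivative along a word `[i₁, …, iₖ]` of directions, the derivative with
respect to `i₁` being taken first. -/
def wordD (w : List (Fin n)) (g : E n → ℝ) : E n → ℝ :=
  w.foldl (fun h i => partialD i h) g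

@[simp] theorem wordD_nil (g : E n → ℝ) : wordD [] g = g := rfl

@[simp] theorem wordD_cons (i : Fin n) (w : List (Fin n)) (g : E n → ℝ) :
    wordD (i :: w) g = wordD w (partialD i g) := rfl

theorem wordD_append (v w : List (Fin n)) (g : E n → ℝ) :
    wordD (v ++ w) g = wordD w (wordD v g) := by
  simp [wordD]

theorem wordD_replicate (k : ℕ) (i : Fin n) (g : E n → ℝ) :
    wordD (List.replicate k i) g = (partialD i)^[k] g := by
  induction k generalizing g with
  | zero => rfl
  | succ k ih => rw [List.replicate_succ, wordD_cons, ih, Function.iterate_succ_apply]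

theorem wordD_congr (w : List (Fin n)) {g g' : E n → ℝ} {O : Set (E n)} (hO : IsOpen O)
    (h : EqOn g g' (O ∩ halfSpace n)) : EqOn (wordD w g) (wordD w g') (O ∩ halfSpace n) := by
  induction w generalizing g g' with
  | nil => exact h
  | cons i w ih => exact ih (partialD_congr i hO h)

theorem ContDiffOn.wordD {g : E n → ℝ} {O : Set (E n)} (hO : IsOpen O)
    (hg : ContDiffOn ℝ ∞ g (O ∩ halfSpace n)) (w : List (Fin n)) :
    ContDiffOn ℝ ∞ (wordD w g) (O ∩ halfSpace n) := by
  induction w generalizing g with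
  | nil => exact hg
  | cons i w ih => exact ih (ContDiffOn.partialD hO hg i)

theorem ContDiffOn.wordD' {g : E n → ℝ} (hg : ContDiffOn ℝ ∞ g (halfSpace n))
    (w : List (Fin n)) : ContDiffOn ℝ ∞ (FreeBoundary.wordD w g) (halfSpace n) := by
  have := ContDiffOn.wordD isOpen_univ (g := g) (by simpa using hg) w
  simpa using this

theorem ContDiffOn.partialD' {g : E n → ℝ} (hg : ContDiffOn ℝ ∞ g (halfSpace n))
    (i : Fin n) : ContDiffOn ℝ ∞ (FreeBoundary.partialD i g) (halfSpace n) :=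
  ContDiffOn.wordD' hg [i]

theorem wordD_add_const_mul (w : List (Fin n)) {g h : E n → ℝ} {O : Set (E n)} (hO : IsOpen O)
    (hg : ContDiffOn ℝ ∞ g (O ∩ halfSpace n)) (hh : ContDiffOn ℝ ∞ h (O ∩ halfSpace n)) (c : ℝ) :
    EqOn (wordD w (fun x => g x + c * h x)) (fun x => wordD w g x + c * wordD w h x)
      (O ∩ halfSpace n) := by
  induction w generalizing g h with
  | nil => exact fun _ _ => rfl
  | cons i w ih =>
    exact (wordD_congr w hO (partialD_add_const_mul i hO hg hh c)).trans
      (ih (ContDiffOn.partialD hO hg i) (ContDiffOn.partialD hO hh i))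

/-- Partial derivatives of a function that is smooth on the half-space may be taken in any
order. -/
theorem wordD_perm {v w : List (Fin n)} (h : v.Perm w) {g : E n → ℝ}
    (hg : ContDiffOn ℝ ∞ g (halfSpace n)) : wordD v g = wordD w g := by
  induction h generalizing g with
  | nil => rfl
  | cons i _ ih => exact ih (ContDiffOn.partialD' hg i)
  | swap i j w => simp only [wordD_cons, partialD_comm i j hg]
  | trans _ _ h1 h2 => exact (h1 hg).trans (h2 hg)

/-- `∂^J` is the derivative along a word that begins with the normal direction `0`; its tangential
part `w` does not depend on the number of normal derivatives. -/
theorem iterD_eq_wordD (J : Fin n → ℕ) : ∃ w : List (Fin n), (∀ i ∈ w, i ≠ 0) ∧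
    w.length + J 0 = ∑ i, J i ∧
    ∀ k g, iterD (Function.update J 0 k) g = wordD (List.replicate k 0 ++ w) g := by
  have key : ∀ (l : List (Fin n)) (K : Fin n → ℕ) (g : E n → ℝ),
      l.foldl (fun h i => (partialD i)^[K i] h) g
        = wordD (l.flatMap fun i => List.replicate (K i) i) g := by
    intro l K
    induction l with
    | nil => intro g; rfl
    | cons a l ih =>
      intro g
      rw [List.foldl_cons, ih, List.flatMap_cons, wordD_append, wordD_replicate]
  obtain ⟨m, rfl⟩ := Nat.exists_eq_succ_of_ne_zero (NeZero.ne n)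
  refine ⟨((List.finRange m).map Fin.succ).flatMap fun i => List.replicate (J i) i, ?_, ?_, ?_⟩
  · intro i hi
    simp only [List.mem_flatMap, List.mem_map, List.mem_replicate] at hi
    obtain ⟨a, ⟨b, _, rfl⟩, _, rfl⟩ := hi
    exact Fin.succ_ne_zero b
  · rw [Fin.sum_univ_succ, add_comm]
    congr 1
    rw [List.length_flatMap, List.map_map, ← Fin.sum_univ_def]
    simp
  · intro k g
    rw [iterD, key, List.finRange_succ, List.flatMap_cons]
    congr 2
    rw [List.flatMap_map, List.flatMap_map]
    congr 1

theorem iterD_eq_wordD' (J : Fin n → ℕ) : ∃ w : List (Fin n), ∀ g, iterD J g = wordD w g := by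
  obtain ⟨w, _, _, h⟩ := iterD_eq_wordD J
  exact ⟨_, fun g => by simpa using h (J 0) g⟩

theorem iterD_congr (J : Fin n → ℕ) {g g' : E n → ℝ} {O : Set (E n)} (hO : IsOpen O)
    (h : EqOn g g' (O ∩ halfSpace n)) : EqOn (iterD J g) (iterD J g') (O ∩ halfSpace n) := by
  obtain ⟨w, hw⟩ := iterD_eq_wordD' J
  rw [hw, hw]
  exact wordD_congr w hO h

theorem ContDiffOn.iterD {g : E n → ℝ} {O : Set (E n)} (hO : IsOpen O)
    (hg : ContDiffOn ℝ ∞ g (O ∩ halfSpace n)) (J : Fin n → ℕ) :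
    ContDiffOn ℝ ∞ (iterD J g) (O ∩ halfSpace n) := by
  obtain ⟨w, hw⟩ := iterD_eq_wordD' J
  rw [hw]
  exact ContDiffOn.wordD hO hg w

theorem iterD_add_const_mul (J : Fin n → ℕ) {g h : E n → ℝ} {O : Set (E n)} (hO : IsOpen O)
    (hg : ContDiffOn ℝ ∞ g (O ∩ halfSpace n)) (hh : ContDiffOn ℝ ∞ h (O ∩ halfSpace n)) (c : ℝ) :
    EqOn (iterD J (fun x => g x + c * h x)) (fun x => iterD J g x + c * iterD J h x)
      (O ∩ halfSpace n) := by
  obtain ⟨w, hw⟩ := iterD_eq_wordD' J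
  simp only [hw]
  exact wordD_add_const_mul w hO hg hh c

theorem support_partialD_subset (i : Fin n) (g : E n → ℝ) :
    Function.support (partialD i g) ⊆ tsupport g := by
  intro x hx
  by_contra hxs
  refine hx ?_
  have h0 : g =ᶠ[𝓝 x] fun _ => 0 := notMem_tsupport_iff_eventuallyEq.1 hxs
  rw [partialD, (h0.filter_mono nhdsWithin_le_nhds).fderivWithin_eq h0.self_of_nhds]
  simp

theorem tsupport_wordD_subset (w : List (Fin n)) (g : E n → ℝ) :
    tsupport (wordD w g) ⊆ tsupport g := by
  induction w generalizing g with
  | nil => exact Subset.rfl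
  | cons i w ih =>
    exact (ih _).trans (closure_minimal (support_partialD_subset i g) (isClosed_tsupport g))

theorem hasCompactSupport_wordD (w : List (Fin n)) {g : E n → ℝ} (hg : HasCompactSupport g) :
    HasCompactSupport (wordD w g) :=
  hg.of_isClosed_subset (isClosed_tsupport _) (tsupport_wordD_subset w g)

theorem tsupport_iterD_subset (J : Fin n → ℕ) (g : E n → ℝ) :
    tsupport (iterD J g) ⊆ tsupport g := by
  obtain ⟨w, hw⟩ := iterD_eq_wordD' J
  rw [hw]
  exact tsupport_wordD_subset w g

end HalfSpace

/-! ### Integration by parts on the half-space -/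

section IntegrationByParts

variable {n : ℕ} [NeZero n]

theorem integrableOn_halfSpace {G : E n → ℝ} (hG : ContinuousOn G (halfSpace n))
    (hc : HasCompactSupport G) : IntegrableOn G (halfSpace n) := by
  have h1 : IntegrableOn G (halfSpace n ∩ tsupport G) :=
    (hG.mono inter_subset_left).integrableOn_compact (hc.isCompact.inter_left isClosed_halfSpace)
  exact h1.of_forall_sdiff_eq_zero isClosed_halfSpace.measurableSet fun x hx =>
    image_eq_zero_of_notMem_tsupport fun h => hx.2 ⟨hx.1, h⟩

theorem integrable_partialD {G : E n → ℝ} (hG : ContDiffOn ℝ ∞ G (halfSpace n))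
    (hc : HasCompactSupport G) (i : Fin n) : Integrable (partialD i G) := by
  have h := integrableOn_halfSpace (ContDiffOn.partialD' hG i).continuousOn
    (hasCompactSupport_wordD [i] hc)
  rw [← integrable_indicator_iff isClosed_halfSpace.measurableSet] at h
  convert! h using 1
  ext x
  by_cases hx : x ∈ halfSpace n
  · simp [hx]
  · simp [hx, partialD_eq_zero_of_notMem]

theorem setIntegral_partialD (i : Fin n) (G : E n → ℝ) :
    ∫ x in halfSpace n, partialD i G x = ∫ x, partialD i G x :=
  setIntegral_eq_integral_of_forall_compl_eq_zero fun _ hx => partialD_eq_zero_of_notMem i G hx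

/-- Along the coordinate line in direction `i`, a function smooth on the half-space has the
derivative `partialD i`, as long as the line stays in the half-space. -/
theorem hasDerivWithinAt_line {G : E n → ℝ} (hG : ContDiffOn ℝ ∞ G (halfSpace n)) (i : Fin n)
    {x : E n} {T : Set ℝ} {t : ℝ}
    (hT : ∀ s ∈ T, x + s • EuclideanSpace.single i (1 : ℝ) ∈ halfSpace n) (ht : t ∈ T) :
    HasDerivWithinAt (fun s : ℝ => G (x + s • EuclideanSpace.single i (1 : ℝ)))
      (partialD i G (x + t • EuclideanSpace.single i (1 : ℝ))) T t := by
  have h1 : HasFDerivWithinAt G (fderivWithin ℝ G (halfSpace n)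
      (x + t • EuclideanSpace.single i (1 : ℝ))) (halfSpace n)
      (x + t • EuclideanSpace.single i (1 : ℝ)) :=
    (hG.differentiableOn (by simp) _ (hT t ht)).hasFDerivWithinAt
  have h2 : HasDerivWithinAt (fun s : ℝ => x + s • EuclideanSpace.single i (1 : ℝ))
      (EuclideanSpace.single i (1 : ℝ)) T t := by
    simpa using ((hasDerivWithinAt_id t T).smul_const
      (EuclideanSpace.single i (1 : ℝ) : E n)).const_add x
  exact h1.comp_hasDerivWithinAt t h2 hT

/-- A tangential derivative of a compactly supported function has integral zero: extended by zero,
the function remains differentiable in the tangential directions. -/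
theorem integral_partialD_of_ne_zero {i : Fin n} (hi : i ≠ 0) {G : E n → ℝ}
    (hG : ContDiffOn ℝ ∞ G (halfSpace n)) (hc : HasCompactSupport G) :
    ∫ x in halfSpace n, partialD i G x = 0 := by
  rw [setIntegral_partialD]
  have hint := integrableOn_halfSpace hG.continuousOn hc
  rw [← integrable_indicator_iff isClosed_halfSpace.measurableSet] at hint
  have key := integral_bilinear_hasLineDerivAt_right_eq_neg_left_of_integrable
    (μ := (volume : Measure (E n))) (f := (halfSpace n).indicator G) (f' := partialD i G)
    (g := fun _ => (1 : ℝ)) (g' := fun _ => (0 : ℝ)) (v := EuclideanSpace.single i (1 : ℝ))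
    (B := ContinuousLinearMap.mul ℝ ℝ) (by simpa using integrable_partialD hG hc i) (by simp)
    (by simpa using hint) (fun x _ => ?_) (fun x _ => by
      simpa [HasLineDerivAt] using hasDerivAt_const (0 : ℝ) (1 : ℝ))
  · simpa using key.symm
  · have hline : ∀ s : ℝ, (x + s • (EuclideanSpace.single i (1 : ℝ) : E n) ∈ halfSpace n) ↔
        x ∈ halfSpace n := by
      intro s
      simp [halfSpace, hi.symm]
    by_cases hx : x ∈ halfSpace n
    · have := hasDerivWithinAt_line hG i (x := x) (T := univ) (t := 0)
        (fun s _ => (hline s).2 hx) (mem_univ _)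
      rw [hasDerivWithinAt_univ] at this
      simpa [HasLineDerivAt, indicator, hline, hx] using this
    · simpa [HasLineDerivAt, indicator, hline, hx, partialD_eq_zero_of_notMem] using
        hasDerivAt_const (0 : ℝ) (0 : ℝ)

/-- The integral of a normal derivative over the half-space is minus the integral over the boundary
hyperplane, the latter being identified with `ℝᵐ`. -/
theorem integral_partialD_zero_succ {m : ℕ} {G : E (m + 1) → ℝ}
    (hG : ContDiffOn ℝ ∞ G (halfSpace (m + 1))) (hc : HasCompactSupport G) :
    ∫ x in halfSpace (m + 1), partialD 0 G x
      = - ∫ y : Fin m → ℝ, G (WithLp.toLp 2 (Fin.cons 0 y)) := by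
  have hp := integrable_partialD hG hc 0
  have e1 : MeasurePreserving (MeasurableEquiv.toLp 2 (Fin (m + 1) → ℝ)) :=
    PiLp.volume_preserving_toLp (Fin (m + 1))
  have e2 := (volume_preserving_piFinSuccAbove (fun _ : Fin (m + 1) => ℝ) 0).symm
  have e3 := e1.comp e2
  have hemb : MeasurableEmbedding ((MeasurableEquiv.toLp 2 (Fin (m + 1) → ℝ)) ∘
      (MeasurableEquiv.piFinSuccAbove (fun _ : Fin (m + 1) => ℝ) 0).symm) :=
    (MeasurableEquiv.measurableEmbedding _).comp (MeasurableEquiv.measurableEmbedding _)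
  have hval : ∀ (t : ℝ) (y : Fin m → ℝ), ((MeasurableEquiv.toLp 2 (Fin (m + 1) → ℝ)) ∘
      (MeasurableEquiv.piFinSuccAbove (fun _ : Fin (m + 1) => ℝ) 0).symm) (t, y)
      = WithLp.toLp 2 (Fin.cons t y) := by
    intro t y
    simp [MeasurableEquiv.piFinSuccAbove, Fin.insertNthEquiv, Fin.insertNth_zero']
  have hline : ∀ (t : ℝ) (y : Fin m → ℝ), (WithLp.toLp 2 (Fin.cons t y) : E (m + 1))
      = WithLp.toLp 2 (Fin.cons 0 y) + t • EuclideanSpace.single 0 (1 : ℝ) := by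
    intro t y
    ext j
    refine Fin.cases ?_ (fun j => ?_) j <;> simp
  have hfun : (MeasurableEquiv.toLp 2 (Fin (m + 1) → ℝ)) ∘
      (MeasurableEquiv.piFinSuccAbove (fun _ : Fin (m + 1) => ℝ) 0).symm
      = fun q : ℝ × (Fin m → ℝ) => WithLp.toLp 2 (Fin.cons q.1 q.2) :=
    funext fun q => hval q.1 q.2
  rw [hfun] at e3 hemb
  have hp' := (e3.integrable_comp_emb hemb).2 hp
  rw [setIntegral_partialD, ← e3.integral_comp hemb, Measure.volume_eq_prod,
    integral_prod_symm (fun q : ℝ × (Fin m → ℝ) =>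
      partialD 0 G (WithLp.toLp 2 (Fin.cons q.1 q.2))) hp', ← integral_neg]
  refine integral_congr_ae (hp'.prod_left_ae.mono ?_)
  intro y hy
  simp only [Function.comp_apply] at hy ⊢
  have hT : ∀ s ∈ Ici (0 : ℝ), (WithLp.toLp 2 (Fin.cons 0 y) : E (m + 1)) +
      s • EuclideanSpace.single 0 (1 : ℝ) ∈ halfSpace (m + 1) := by
    intro s hs
    rw [← hline]
    simpa [halfSpace] using hs
  have hd : ∀ t ∈ Ici (0 : ℝ), HasDerivWithinAt (fun s => G (WithLp.toLp 2 (Fin.cons s y)))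
      (partialD 0 G (WithLp.toLp 2 (Fin.cons t y))) (Ici 0) t := by
    intro t ht
    have := hasDerivWithinAt_line hG 0 hT ht
    simpa only [← hline] using this
  have hlim : Tendsto (fun s => G (WithLp.toLp 2 (Fin.cons s y))) atTop (𝓝 0) := by
    obtain ⟨R, hR⟩ := hc.isCompact.isBounded.subset_closedBall 0
    refine tendsto_const_nhds.congr' ?_
    filter_upwards [eventually_gt_atTop (max R 0)] with s hs
    refine (image_eq_zero_of_notMem_tsupport fun h => ?_).symm
    have h1 := hR h
    rw [mem_closedBall_zero_iff] at h1
    have h2 := PiLp.norm_apply_le (WithLp.toLp 2 (Fin.cons s y) : E (m + 1)) 0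
    simp only [Fin.cons_zero, Real.norm_eq_abs] at h2
    have := (le_abs_self s).trans (h2.trans h1)
    exact absurd ((le_max_left _ _).trans_lt hs) (not_lt.2 this)
  have h0 : ∫ t : ℝ, partialD 0 G (WithLp.toLp 2 (Fin.cons t y))
      = ∫ t in Ici (0 : ℝ), partialD 0 G (WithLp.toLp 2 (Fin.cons t y)) := by
    refine (setIntegral_eq_integral_of_forall_compl_eq_zero fun t ht => ?_).symm
    exact partialD_eq_zero_of_notMem 0 G (by simpa [halfSpace] using ht)
  rw [h0, integral_Ici_eq_integral_Ioi, integral_Ioi_of_hasDerivAt_of_tendsto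
    (f := fun s => G (WithLp.toLp 2 (Fin.cons s y))) (hd 0 self_mem_Ici).continuousWithinAt
    (fun t ht => (hd t (mem_Ici_of_Ioi ht)).hasDerivAt (Ici_mem_nhds ht)) hy.integrableOn hlim]
  simp

theorem integral_partialD_zero_eq_zero {G : E n → ℝ} (hG : ContDiffOn ℝ ∞ G (halfSpace n))
    (hc : HasCompactSupport G) (h0 : ∀ x : E n, x 0 = 0 → G x = 0) :
    ∫ x in halfSpace n, partialD 0 G x = 0 := by
  obtain ⟨m, rfl⟩ := Nat.exists_eq_succ_of_ne_zero (NeZero.ne n)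
  refine (integral_partialD_zero_succ hG hc).trans ?_
  rw [neg_eq_zero]
  exact integral_eq_zero_of_ae (ae_of_all _ fun y => h0 _ rfl)

theorem integral_partialD_zero_ne_zero {G : E n → ℝ} (hG : ContDiffOn ℝ ∞ G (halfSpace n))
    (hc : HasCompactSupport G) (h0 : ∀ x : E n, x 0 = 0 → 0 ≤ G x)
    (h1 : ∃ x : E n, x 0 = 0 ∧ G x ≠ 0) :
    ∫ x in halfSpace n, partialD 0 G x ≠ 0 := by
  obtain ⟨m, rfl⟩ := Nat.exists_eq_succ_of_ne_zero (NeZero.ne n)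
  intro h
  have h2 := (integral_partialD_zero_succ hG hc).symm.trans h
  rw [neg_eq_zero] at h2
  obtain ⟨x, hx0, hx⟩ := h1
  have hcont : Continuous fun y : Fin m → ℝ => (WithLp.toLp 2 (Fin.cons 0 y) : E (m + 1)) := by
    refine (PiLp.continuous_toLp 2 _).comp ?_
    exact continuous_pi fun j => by
      refine Fin.cases ?_ (fun j => ?_) j <;> simp <;> fun_prop
  have hcl : Topology.IsClosedEmbedding
      fun y : Fin m → ℝ => (WithLp.toLp 2 (Fin.cons 0 y) : E (m + 1)) := by
    refine .of_continuous_injective_isClosedMap hcont ?_ ?_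
    · intro y y' hyy
      have := (WithLp.toLp_injective 2) hyy
      exact (Fin.cons_right_injective (α := fun _ => ℝ) 0) this
    · have hinv : Function.LeftInverse (fun (x : E (m + 1)) (j : Fin m) => x j.succ)
          fun y : Fin m → ℝ => (WithLp.toLp 2 (Fin.cons 0 y) : E (m + 1)) := fun y => by
        ext j; simp
      exact (hinv.isClosedEmbedding (by fun_prop) hcont).isClosedMap
  refine absurd h2 (ne_of_gt ?_)
  refine Continuous.integral_pos_of_hasCompactSupport_nonneg_nonzero
    (x := fun j => x j.succ) ?_ (hc.comp_isClosedEmbedding hcl) (fun y => h0 _ rfl) ?_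
  · exact hG.continuousOn.comp_continuous hcont fun y => le_refl (0 : ℝ)
  · convert hx using 2
    ext j
    refine Fin.cases ?_ (fun j => ?_) j
    · exact hx0.symm
    · rfl

theorem integral_mul_partialD_of_ne_zero {i : Fin n} (hi : i ≠ 0) {a φ : E n → ℝ}
    (ha : ContDiffOn ℝ ∞ a (halfSpace n)) (hφ : ContDiffOn ℝ ∞ φ (halfSpace n))
    (hc : HasCompactSupport φ) :
    ∫ x in halfSpace n, a x * partialD i φ x = - ∫ x in halfSpace n, partialD i a x * φ x := by
  have h := integral_partialD_of_ne_zero hi (ha.mul hφ) hc.mul_left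
  rw [partialD_mul i ha hφ, integral_add] at h
  · linarith
  · exact integrableOn_halfSpace ((ContDiffOn.partialD' ha i).mul hφ).continuousOn hc.mul_left
  · exact integrableOn_halfSpace (ha.mul (ContDiffOn.partialD' hφ i)).continuousOn
      (hasCompactSupport_wordD [i] hc).mul_left

theorem integral_mul_partialD_zero {a φ : E n → ℝ}
    (ha : ContDiffOn ℝ ∞ a (halfSpace n)) (hφ : ContDiffOn ℝ ∞ φ (halfSpace n))
    (hc : HasCompactSupport φ) :
    ∫ x in halfSpace n, a x * partialD 0 φ x
      = (∫ x in halfSpace n, partialD 0 (fun z => a z * φ z) x)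
        - ∫ x in halfSpace n, partialD 0 a x * φ x := by
  rw [partialD_mul 0 ha hφ, integral_add]
  · ring
  · exact integrableOn_halfSpace ((ContDiffOn.partialD' ha 0).mul hφ).continuousOn hc.mul_left
  · exact integrableOn_halfSpace (ha.mul (ContDiffOn.partialD' hφ 0)).continuousOn
      (hasCompactSupport_wordD [0] hc).mul_left

theorem integral_mul_wordD {w : List (Fin n)} (hw : ∀ i ∈ w, i ≠ 0) {a φ : E n → ℝ}
    (ha : ContDiffOn ℝ ∞ a (halfSpace n)) (hφ : ContDiffOn ℝ ∞ φ (halfSpace n))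
    (hc : HasCompactSupport φ) :
    ∫ x in halfSpace n, a x * wordD w φ x
      = (-1) ^ w.length * ∫ x in halfSpace n, wordD w a x * φ x := by
  induction w generalizing φ with
  | nil => simp
  | cons i w ih =>
    have hperm : wordD (i :: w) a = partialD i (wordD w a) := by
      rw [wordD_perm (List.perm_append_singleton i w).symm ha, wordD_append]
      rfl
    rw [wordD_cons, ih (fun j hj => hw j (List.mem_cons_of_mem _ hj))
      (ContDiffOn.partialD' hφ i) (hasCompactSupport_wordD [i] hc),
      integral_mul_partialD_of_ne_zero (hw i List.mem_cons_self) (ContDiffOn.wordD' ha w) hφ hc,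
      hperm, List.length_cons]
    ring

theorem contDiffOn_iterate_partialD {φ : E n → ℝ} (hφ : ContDiffOn ℝ ∞ φ (halfSpace n))
    (k : ℕ) (i : Fin n) : ContDiffOn ℝ ∞ ((partialD i)^[k] φ) (halfSpace n) := by
  rw [← wordD_replicate]
  exact ContDiffOn.wordD' hφ _

theorem hasCompactSupport_iterate_partialD {φ : E n → ℝ} (hc : HasCompactSupport φ)
    (k : ℕ) (i : Fin n) : HasCompactSupport ((partialD i)^[k] φ) := by
  rw [← wordD_replicate]
  exact hasCompactSupport_wordD _ hc

/-- Repeated integration by parts in the normal direction. Each boundary term is kept as the integral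
of a normal derivative, which depends on the boundary values only. -/
theorem integral_mul_iterate_partialD_zero (k : ℕ) {a φ : E n → ℝ}
    (ha : ContDiffOn ℝ ∞ a (halfSpace n)) (hφ : ContDiffOn ℝ ∞ φ (halfSpace n))
    (hc : HasCompactSupport φ) :
    ∫ x in halfSpace n, a x * (partialD 0)^[k] φ x
      = (-1) ^ k * (∫ x in halfSpace n, (partialD 0)^[k] a x * φ x)
        + ∑ α ∈ Finset.range k, (-1) ^ (k - α - 1) * ∫ x in halfSpace n,
          partialD 0 (fun z => (partialD 0)^[k - α - 1] a z * (partialD 0)^[α] φ z) x := by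
  induction k generalizing a with
  | zero => simp
  | succ k ih =>
    have h1 := integral_mul_partialD_zero ha (contDiffOn_iterate_partialD hφ k 0)
      (hasCompactSupport_iterate_partialD hc k 0)
    have h2 := ih (ContDiffOn.partialD' ha 0)
    rw [Function.iterate_succ_apply' (partialD 0) k φ, h1, h2, Finset.sum_range_succ]
    have h3 : ∀ α ∈ Finset.range k, (-1 : ℝ) ^ (k + 1 - α - 1) * ∫ x in halfSpace n,
          partialD 0 (fun z => (partialD 0)^[k + 1 - α - 1] a z * (partialD 0)^[α] φ z) x
        = -((-1) ^ (k - α - 1) * ∫ x in halfSpace n,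
          partialD 0 (fun z => (partialD 0)^[k - α - 1] (partialD 0 a) z
            * (partialD 0)^[α] φ z) x) := by
      intro α hα
      have : k + 1 - α - 1 = (k - α - 1) + 1 := by
        have := Finset.mem_range.1 hα; omega
      rw [this, Function.iterate_succ_apply]
      ring
    rw [Finset.sum_congr rfl h3]
    simp only [Finset.sum_neg_distrib, Function.iterate_succ_apply]
    simp
    ring

end IntegrationByParts

/-! ### The fundamental lemma of the calculus of variations with free boundary values -/

section FundamentalLemma

variable {n : ℕ} [NeZero n] {r : ℕ}

/-- The expression `∑ (-1)^|I| ∂^I a_I` formed from functions `a_I`, `|I| ≤ r`. -/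
def eulerSum (a : MultiIndex n r → E n → ℝ) (x : E n) : ℝ :=
  ∑ I : MultiIndex n r, (-1) ^ I.length * iterD I.entries (a I) x

/-- The coefficient of `∂₀^α φ` in the boundary term that arises when the derivatives are moved
from `φ` to `a_I` in `∑ ∫ a_I ∂^I φ`. -/
def boundarySum (a : MultiIndex n r → E n → ℝ) (α : ℕ) (x : E n) : ℝ :=
  ∑ I : MultiIndex n r with α < I.entries 0, (-1) ^ (I.length - α - 1) *
    iterD (Function.update I.entries 0 (I.entries 0 - α - 1)) (a I) x

theorem contDiffOn_iterD_halfSpace {g : E n → ℝ} (hg : ContDiffOn ℝ ∞ g (halfSpace n))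
    (J : Fin n → ℕ) : ContDiffOn ℝ ∞ (iterD J g) (halfSpace n) := by
  obtain ⟨w, hw⟩ := iterD_eq_wordD' J
  rw [hw]
  exact ContDiffOn.wordD' hg w

theorem contDiffOn_eulerSum {a : MultiIndex n r → E n → ℝ}
    (ha : ∀ I, ContDiffOn ℝ ∞ (a I) (halfSpace n)) :
    ContDiffOn ℝ ∞ (eulerSum a) (halfSpace n) :=
  ContDiffOn.sum fun I _ => contDiffOn_const.mul (contDiffOn_iterD_halfSpace (ha I) _)

theorem contDiffOn_boundarySum {a : MultiIndex n r → E n → ℝ}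
    (ha : ∀ I, ContDiffOn ℝ ∞ (a I) (halfSpace n)) (α : ℕ) :
    ContDiffOn ℝ ∞ (boundarySum a α) (halfSpace n) :=
  ContDiffOn.sum fun I _ => contDiffOn_const.mul (contDiffOn_iterD_halfSpace (ha I) _)

theorem partialD_sum (i : Fin n) {ι : Type*} (s : Finset ι) (c : ι → ℝ) {G : ι → E n → ℝ}
    (hG : ∀ j ∈ s, ContDiffOn ℝ ∞ (G j) (halfSpace n)) :
    partialD i (fun x => ∑ j ∈ s, c j * G j x) = fun x => ∑ j ∈ s, c j * partialD i (G j) x := by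
  classical
  ext x
  by_cases hx : x ∈ halfSpace n
  · simp only [partialD]
    have hd : ∀ j ∈ s, HasFDerivWithinAt (fun x => c j * G j x)
        (c j • fderivWithin ℝ (G j) (halfSpace n) x) (halfSpace n) x := fun j hj =>
      ((hG j hj).differentiableOn (by simp) x hx).hasFDerivWithinAt.const_mul (c j)
    rw [(HasFDerivWithinAt.fun_sum hd).fderivWithin (uniqueDiffOn_halfSpace x hx)]
    simp
  · simp [partialD_eq_zero_of_notMem _ _ hx]

theorem integral_partialD_sum (i : Fin n) {ι : Type*} (s : Finset ι) (c : ι → ℝ)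
    {G : ι → E n → ℝ} (hG : ∀ j ∈ s, ContDiffOn ℝ ∞ (G j) (halfSpace n))
    (hc : ∀ j ∈ s, HasCompactSupport (G j)) :
    ∫ x in halfSpace n, partialD i (fun x => ∑ j ∈ s, c j * G j x) x
      = ∑ j ∈ s, c j * ∫ x in halfSpace n, partialD i (G j) x := by
  rw [partialD_sum i s c hG, integral_finsetSum]
  · simp [integral_const_mul]
  · intro j hj
    exact ((integrable_partialD (hG j hj) (hc j hj) i).const_mul _).integrableOn

/-- Integration by parts for `∂^J`, the tangential derivatives being moved before the normal
ones. -/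
theorem integral_mul_iterD (J : Fin n → ℕ) {a φ : E n → ℝ}
    (ha : ContDiffOn ℝ ∞ a (halfSpace n)) (hφ : ContDiffOn ℝ ∞ φ (halfSpace n))
    (hc : HasCompactSupport φ) :
    ∫ x in halfSpace n, a x * iterD J φ x
      = (-1) ^ (∑ i, J i) * (∫ x in halfSpace n, iterD J a x * φ x)
        + ∑ α ∈ Finset.range (J 0), (-1) ^ (∑ i, J i - α - 1) * ∫ x in halfSpace n,
          partialD 0 (fun z => iterD (Function.update J 0 (J 0 - α - 1)) a z
            * (partialD 0)^[α] φ z) x := by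
  obtain ⟨w, hw, hlen, hJ⟩ := iterD_eq_wordD J
  have h1 : iterD J φ = wordD w ((partialD 0)^[J 0] φ) := by
    have := hJ (J 0) φ
    rwa [Function.update_eq_self, wordD_append, wordD_replicate] at this
  have h2 : ∀ k, (partialD 0)^[k] (wordD w a) = iterD (Function.update J 0 k) a := by
    intro k
    rw [hJ, ← wordD_replicate, ← wordD_append, wordD_perm List.perm_append_comm ha]
  have h3 : (partialD 0)^[J 0] (wordD w a) = iterD J a := by
    rw [h2, Function.update_eq_self]
  rw [h1, integral_mul_wordD hw ha (contDiffOn_iterate_partialD hφ _ _)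
    (hasCompactSupport_iterate_partialD hc _ _),
    integral_mul_iterate_partialD_zero _ (ContDiffOn.wordD' ha w) hφ hc, h3, ← hlen, mul_add,
    Finset.mul_sum, pow_add, mul_assoc]
  congr 1
  refine Finset.sum_congr rfl fun α hα => ?_
  have : w.length + J 0 - α - 1 = w.length + (J 0 - α - 1) := by
    have := Finset.mem_range.1 hα; omega
  rw [h2, this, pow_add, mul_assoc]

/-- Integration by parts in the first variation. The boundary term is written as the
integral of a normal derivative. -/
theorem sum_integral_mul_iterD {a : MultiIndex n r → E n → ℝ} {φ : E n → ℝ}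
    (ha : ∀ I, ContDiffOn ℝ ∞ (a I) (halfSpace n)) (hφ : ContDiffOn ℝ ∞ φ (halfSpace n))
    (hc : HasCompactSupport φ) :
    ∑ I, ∫ x in halfSpace n, a I x * iterD I.entries φ x
      = (∫ x in halfSpace n, eulerSum a x * φ x)
        + ∫ x in halfSpace n, partialD 0 (fun z => ∑ α ∈ Finset.range r,
            boundarySum a α z * (partialD 0)^[α] φ z) x := by
  have hprod : ∀ (I : MultiIndex n r) (J : Fin n → ℕ) (α : ℕ),
      ContDiffOn ℝ ∞ (fun z => iterD J (a I) z * (partialD 0)^[α] φ z) (halfSpace n) :=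
    fun I J α => (contDiffOn_iterD_halfSpace (ha I) J).mul (contDiffOn_iterate_partialD hφ α 0)
  have hprodc : ∀ (I : MultiIndex n r) (J : Fin n → ℕ) (α : ℕ),
      HasCompactSupport (fun z => iterD J (a I) z * (partialD 0)^[α] φ z) :=
    fun I J α => (hasCompactSupport_iterate_partialD hc α 0).mul_left
  simp only [fun I : MultiIndex n r => integral_mul_iterD I.entries (ha I) hφ hc]
  rw [Finset.sum_add_distrib]
  congr 1
  · simp only [eulerSum, Finset.sum_mul]
    rw [integral_finsetSum]
    · simp only [mul_assoc, integral_const_mul]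
      rfl
    · intro I _
      simp only [mul_assoc]
      exact (integrableOn_halfSpace
        ((contDiffOn_iterD_halfSpace (ha I) _).mul hφ).continuousOn hc.mul_left).const_mul _
  · have h1 : ∀ α, (fun z => boundarySum a α z * (partialD 0)^[α] φ z) = fun z =>
        ∑ I : MultiIndex n r with α < I.entries 0, (-1) ^ (I.length - α - 1) *
          (iterD (Function.update I.entries 0 (I.entries 0 - α - 1)) (a I) z
            * (partialD 0)^[α] φ z) := by
      intro α
      ext z
      simp only [boundarySum, Finset.sum_mul, mul_assoc]
    have h2 := integral_partialD_sum 0 (Finset.range r) (fun _ => 1)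
      (G := fun α z => boundarySum a α z * (partialD 0)^[α] φ z)
      (fun α _ => (contDiffOn_boundarySum ha α).mul (contDiffOn_iterate_partialD hφ α 0))
      (fun α _ => (hasCompactSupport_iterate_partialD hc α 0).mul_left)
    simp only [one_mul] at h2
    rw [h2]
    have h3 : ∀ α, ∫ x in halfSpace n,
        partialD 0 (fun z => boundarySum a α z * (partialD 0)^[α] φ z) x
        = ∑ I : MultiIndex n r with α < I.entries 0, (-1) ^ (I.length - α - 1) *
          ∫ x in halfSpace n, partialD 0 (fun z =>
            iterD (Function.update I.entries 0 (I.entries 0 - α - 1)) (a I) z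
            * (partialD 0)^[α] φ z) x := by
      intro α
      rw [h1]
      exact integral_partialD_sum 0 _ _ (fun I _ => hprod I _ α) (fun I _ => hprodc I _ α)
    simp only [h3]
    refine Finset.sum_comm' fun I α => ?_
    have : I.entries 0 ≤ r := Nat.lt_succ_iff.1 (I.1 0).2
    simp only [Finset.mem_univ, Finset.mem_range, Finset.mem_filter, true_and]
    omega

theorem partialD_zero_pow_mul (k : ℕ) {η : E n → ℝ} (hη : ContDiffOn ℝ ∞ η (halfSpace n))
    {x : E n} (hx : x ∈ halfSpace n) :
    partialD 0 (fun z => z 0 ^ (k + 1) * η z) x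
      = x 0 ^ k * ((k + 1) * η x + x 0 * partialD 0 η x) := by
  have hp : ContDiffOn ℝ ∞ (fun z : E n => z 0 ^ (k + 1)) (halfSpace n) :=
    ContDiff.contDiffOn (by fun_prop)
  rw [partialD_mul 0 hp hη]
  have h1 : HasFDerivAt (fun z : E n => z 0)
      (EuclideanSpace.proj (0 : Fin n) : E n →L[ℝ] ℝ) x :=
    (EuclideanSpace.proj (0 : Fin n) : E n →L[ℝ] ℝ).hasFDerivAt
  have h2 : partialD 0 (fun z : E n => z 0 ^ (k + 1)) x = (k + 1) * x 0 ^ k := by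
    rw [partialD, (h1.pow (k + 1)).hasFDerivWithinAt.fderivWithin (uniqueDiffOn_halfSpace x hx)]
    simp
  simp only [h2]
  ring

/-- The normal derivatives of order `α ≤ k` of `x₀ᵏ η` vanish on the boundary for `α < k`, and
the one of order `k` is `k! η`. -/
theorem iterate_partialD_zero_pow_mul (k : ℕ) {η : E n → ℝ}
    (hη : ContDiffOn ℝ ∞ η (halfSpace n)) {α : ℕ} (hα : α ≤ k) {x : E n} (hx : x 0 = 0) :
    (partialD 0)^[α] (fun z => z 0 ^ k * η z) x = if α = k then k.factorial * η x else 0 := by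
  induction k generalizing η α with
  | zero =>
    obtain rfl : α = 0 := by omega
    simp
  | succ k ih =>
    have hxH : x ∈ halfSpace n := le_of_eq hx.symm
    cases α with
    | zero => simp [hx]
    | succ α =>
      have hη' : ContDiffOn ℝ ∞ (fun z : E n => (k + 1) * η z + z 0 * partialD 0 η z)
          (halfSpace n) :=
        (contDiffOn_const.mul hη).add
          ((ContDiff.contDiffOn (by fun_prop)).mul (ContDiffOn.partialD' hη 0))
      have h1 := ih hη' (Nat.le_of_succ_le_succ hα)
      rw [Function.iterate_succ_apply, ← wordD_replicate]
      rw [← wordD_replicate] at h1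
      have h2 := wordD_congr (List.replicate α 0) isOpen_univ
        (g := partialD 0 (fun z => z 0 ^ (k + 1) * η z))
        (g' := fun z => z 0 ^ k * ((k + 1) * η z + z 0 * partialD 0 η z))
        (fun z hz => partialD_zero_pow_mul k hη hz.2) ⟨mem_univ x, hxH⟩
      rw [h2, h1]
      by_cases h : α = k
      · simp [h, hx, Nat.factorial_succ]
        ring
      · simp [h]

/-- A bump function at `x` on the support of which `f` has the sign of `f x`. -/
theorem exists_bump {f : E n → ℝ} (hf : ContinuousOn f (halfSpace n)) {O : Set (E n)}
    (hO : IsOpen O) {x : E n} (hx : x ∈ O ∩ halfSpace n) (hfx : f x ≠ 0) :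
    ∃ ψ : E n → ℝ, ContDiff ℝ ∞ ψ ∧ HasCompactSupport ψ ∧ tsupport ψ ⊆ O ∧ (∀ y, 0 ≤ ψ y) ∧
      ψ x = 1 ∧ ∀ y ∈ halfSpace n, y ∈ tsupport ψ → 0 < f x * f y := by
  have h1 : ∀ᶠ y in 𝓝[halfSpace n] x, 0 < f x * f y :=
    ((hf x hx.2).const_mul (f x)).eventually_const_lt (mul_self_pos.2 hfx)
  rw [eventually_nhdsWithin_iff] at h1
  obtain ⟨ε, hε, hball⟩ := Metric.eventually_nhds_iff_ball.1 (h1.and (hO.mem_nhds hx.1))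
  let ψ : ContDiffBump x := ⟨ε / 4, ε / 2, by positivity, by linarith⟩
  have hsub : tsupport ψ ⊆ Metric.ball x ε := by
    rw [ψ.tsupport_eq]
    exact Metric.closedBall_subset_ball (by change ε / 2 < ε; linarith)
  exact ⟨ψ, ψ.contDiff, ψ.hasCompactSupport, fun y hy => (hball y (hsub hy)).2,
    fun y => ψ.nonneg, ψ.one_of_mem_closedBall (Metric.mem_closedBall_self ψ.rIn_pos.le),
    fun y hyH hy => (hball y (hsub hy)).1 hyH⟩

/-- The fundamental lemma. The test functions `x₀ʳ ψ` have no boundary terms and give the vanishing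
of the Euler sum, up to the boundary by continuity. Then `x₀ᵏ ψ` isolates the boundary sum of
index `k`: the terms with `α < k` vanish because of the factor `x₀ᵏ`, those with `α > k`
by downward induction. -/
theorem euler_of_variation {a : MultiIndex n r → E n → ℝ}
    (ha : ∀ I, ContDiffOn ℝ ∞ (a I) (halfSpace n)) {O : Set (E n)} (hO : IsOpen O)
    (hvar : ∀ φ : E n → ℝ, ContDiff ℝ ∞ φ → HasCompactSupport φ → tsupport φ ⊆ O →
      ∑ I, ∫ x in halfSpace n, a I x * iterD I.entries φ x = 0) :
    (∀ x ∈ O ∩ halfSpace n, eulerSum a x = 0) ∧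
      ∀ α < r, ∀ x ∈ O, x 0 = 0 → boundarySum a α x = 0 := by
  -- the test functions are `x₀ᵏ ψ` with a bump function `ψ`
  have htest : ∀ (k : ℕ) (ψ : E n → ℝ), ContDiff ℝ ∞ ψ → HasCompactSupport ψ → tsupport ψ ⊆ O →
      (∫ x in halfSpace n, eulerSum a x * (x 0 ^ k * ψ x))
        + ∫ x in halfSpace n, partialD 0 (fun z => ∑ α ∈ Finset.range r,
            boundarySum a α z * (partialD 0)^[α] (fun z => z 0 ^ k * ψ z) z) x = 0 := by
    intro k ψ hψ hψc hψO
    have h1 : ContDiff ℝ ∞ fun z : E n => z 0 ^ k * ψ z := by fun_prop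
    rw [← sum_integral_mul_iterD ha h1.contDiffOn hψc.mul_left]
    exact hvar _ h1 hψc.mul_left ((tsupport_mul_subset_right).trans hψO)
  have hsmooth : ∀ (k : ℕ) (ψ : E n → ℝ), ContDiff ℝ ∞ ψ →
      ContDiffOn ℝ ∞ (fun z => ∑ α ∈ Finset.range r,
        boundarySum a α z * (partialD 0)^[α] (fun z => z 0 ^ k * ψ z) z) (halfSpace n) := by
    intro k ψ hψ
    have h1 : ContDiff ℝ ∞ fun z : E n => z 0 ^ k * ψ z := by fun_prop
    exact ContDiffOn.sum fun α _ =>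
      (contDiffOn_boundarySum ha α).mul (contDiffOn_iterate_partialD h1.contDiffOn α 0)
  have hts : ∀ (k : ℕ) (ψ : E n → ℝ), tsupport (fun z => ∑ α ∈ Finset.range r,
        boundarySum a α z * (partialD 0)^[α] (fun z => z 0 ^ k * ψ z) z) ⊆ tsupport ψ := by
    intro k ψ
    refine closure_minimal (fun x hx => ?_) (isClosed_tsupport ψ)
    by_contra hxs
    refine hx (Finset.sum_eq_zero fun α _ => ?_)
    rw [← wordD_replicate]
    rw [image_eq_zero_of_notMem_tsupport (f := wordD _ _), mul_zero]
    exact fun h => hxs (tsupport_mul_subset_right (tsupport_wordD_subset _ _ h))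
  have hEL : ∀ x ∈ O ∩ halfSpace n, eulerSum a x = 0 := by
    intro x hx
    by_contra hne
    have hcont := (contDiffOn_eulerSum ha).continuousOn
    obtain ⟨ψ, hψ, hψc, hψO, hψ0, hψx, hpos⟩ := exists_bump hcont hO hx hne
    have h1 := htest r ψ hψ hψc hψO
    rw [integral_partialD_zero_eq_zero (hsmooth r ψ hψ)
      (hψc.of_isClosed_subset (isClosed_tsupport _) (hts r ψ)), add_zero] at h1
    · have hF : ContinuousOn (fun y => eulerSum a x * (eulerSum a y * (y 0 ^ r * ψ y)))
          (halfSpace n) := by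
        have : Continuous fun y : E n => y 0 ^ r * ψ y := by
          have := hψ.continuous
          fun_prop
        exact continuousOn_const.mul (hcont.mul this.continuousOn)
      have h2 : ∫ y in halfSpace n, eulerSum a x * (eulerSum a y * (y 0 ^ r * ψ y)) = 0 := by
        rw [integral_const_mul, h1, mul_zero]
      rw [setIntegral_eq_zero_iff_of_nonneg_ae] at h2
      · have h3 := Measure.eqOn_open_of_ae_eq (ae_restrict_of_ae_restrict_of_subset
          interior_subset h2) isOpen_interior (hF.mono interior_subset) continuousOn_const
        have h4 : ∀ᶠ y in 𝓝 x, 0 < ψ y :=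
          hψ.continuous.continuousAt.eventually_const_lt (by rw [hψx]; exact one_pos)
        have h5 : x ∈ closure (interior (halfSpace n)) := by
          rw [closure_interior_halfSpace]; exact hx.2
        obtain ⟨y, hy, hyi⟩ := (mem_closure_iff_frequently.1 h5).and_eventually h4 |>.exists
        have h6 := h3 hy
        have h7 := hpos y (interior_subset hy) (subset_tsupport _ hyi.ne')
        rw [interior_halfSpace_eq] at hy
        have h8 : 0 < eulerSum a x * eulerSum a y * (y 0 ^ r * ψ y) :=
          mul_pos h7 (mul_pos (pow_pos hy r) hyi)
        rw [mul_assoc] at h8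
        exact h8.ne' h6
      · refine (ae_restrict_iff' isClosed_halfSpace.measurableSet).2 (ae_of_all _ fun y hy => ?_)
        change 0 ≤ eulerSum a x * (eulerSum a y * (y 0 ^ r * ψ y))
        by_cases hys : y ∈ tsupport ψ
        · rw [← mul_assoc]
          exact mul_nonneg (hpos y hy hys).le (mul_nonneg (pow_nonneg hy r) (hψ0 y))
        · simp [image_eq_zero_of_notMem_tsupport hys]
      · refine integrableOn_halfSpace hF ?_
        exact ((hψc.mul_left).mul_left).mul_left
    · intro y hy
      refine Finset.sum_eq_zero fun α hα => ?_
      have hα' := Finset.mem_range.1 hα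
      rw [iterate_partialD_zero_pow_mul r hψ.contDiffOn hα'.le hy, if_neg hα'.ne, mul_zero]
  refine ⟨hEL, ?_⟩
  have hstep : ∀ k < r, (∀ α, k < α → α < r → ∀ x ∈ O, x 0 = 0 → boundarySum a α x = 0) →
      ∀ x ∈ O, x 0 = 0 → boundarySum a k x = 0 := by
    intro k hk hhigher x hxO hx0
    by_contra hne
    have hcont := (contDiffOn_boundarySum ha k).continuousOn
    obtain ⟨ψ, hψ, hψc, hψO, hψ0, hψx, hpos⟩ :=
      exists_bump hcont hO ⟨hxO, le_of_eq hx0.symm⟩ hne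
    have h1 := htest k ψ hψ hψc hψO
    have h0 : ∫ x in halfSpace n, eulerSum a x * (x 0 ^ k * ψ x) = 0 := by
      refine setIntegral_eq_zero_of_forall_eq_zero fun y hy => ?_
      by_cases hys : y ∈ tsupport ψ
      · rw [hEL y ⟨hψO hys, hy⟩, zero_mul]
      · simp [image_eq_zero_of_notMem_tsupport hys]
    rw [h0, zero_add] at h1
    set G : E n → ℝ := fun z => ∑ α ∈ Finset.range r,
        boundarySum a α z * (partialD 0)^[α] (fun z => z 0 ^ k * ψ z) z with hG
    have hGb : ∀ y : E n, y 0 = 0 → G y = boundarySum a k y * (k.factorial * ψ y) := by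
      intro y hy
      by_cases hys : y ∈ tsupport ψ
      · rw [hG]
        simp only
        rw [Finset.sum_eq_single k]
        · rw [iterate_partialD_zero_pow_mul k hψ.contDiffOn le_rfl hy, if_pos rfl]
        · intro α hα hαk
          rcases lt_or_gt_of_ne hαk with h | h
          · rw [iterate_partialD_zero_pow_mul k hψ.contDiffOn h.le hy, if_neg hαk, mul_zero]
          · rw [hhigher α h (Finset.mem_range.1 hα) y (hψO hys) hy, zero_mul]
        · exact fun h => absurd (Finset.mem_range.2 hk) h
      · rw [image_eq_zero_of_notMem_tsupport hys, image_eq_zero_of_notMem_tsupport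
          (f := G) (fun h => hys (hts k ψ h))]
        simp
    have hGs := hsmooth k ψ hψ
    have hGc : HasCompactSupport G := hψc.of_isClosed_subset (isClosed_tsupport _) (hts k ψ)
    refine integral_partialD_zero_ne_zero (G := fun z => boundarySum a k x * G z)
      (contDiffOn_const.mul hGs) hGc.mul_left ?_ ⟨x, hx0, ?_⟩ ?_
    · intro y hy
      rw [hGb y hy, ← mul_assoc]
      by_cases hys : y ∈ tsupport ψ
      · exact mul_nonneg (hpos y (le_of_eq hy.symm) hys).le
          (mul_nonneg (Nat.cast_nonneg _) (hψ0 y))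
      · simp [image_eq_zero_of_notMem_tsupport hys]
    · rw [hGb x hx0, hψx]
      simpa [hne] using Nat.factorial_ne_zero k
    · have := integral_partialD_sum 0 ({0} : Finset ℕ) (fun _ => boundarySum a k x)
        (G := fun _ => G) (fun _ _ => hGs) (fun _ _ => hGc)
      simp only [Finset.sum_singleton] at this
      rw [this, h1, mul_zero]
  intro α hα
  induction hd : r - α using Nat.strong_induction_on generalizing α with
  | _ d ih =>
    refine hstep α hα fun β hβ hβr => ih (r - β) (by omega) β hβr rfl

/-- The local form of `euler_of_variation`: the functions `a_I` need only be smooth on a relatively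
open subset of the half-space, and only test functions with small supports are used. -/
theorem euler_of_local_variation {a : MultiIndex n r → E n → ℝ} {O : Set (E n)} (hO : IsOpen O)
    (ha : ∀ I, ContDiffOn ℝ ∞ (a I) (O ∩ halfSpace n))
    (hvar : ∀ x ∈ O ∩ halfSpace n, ∃ U : Set (E n), IsOpen U ∧ x ∈ U ∧
      ∀ φ : E n → ℝ, ContDiff ℝ ∞ φ → HasCompactSupport φ → tsupport φ ⊆ U →
        ∑ I, ∫ x in halfSpace n, a I x * iterD I.entries φ x = 0) :
    ∀ x ∈ O ∩ halfSpace n, eulerSum a x = 0 ∧ (x 0 = 0 → ∀ α < r, boundarySum a α x = 0) := by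
  intro x hx
  obtain ⟨U, hU, hxU, hvarU⟩ := hvar x hx
  obtain ⟨ε, hε, hball⟩ := Metric.isOpen_iff.1 (hO.inter hU) x ⟨hx.1, hxU⟩
  let χ : ContDiffBump x := ⟨ε / 3, ε / 2, by positivity, by linarith⟩
  have hχO : tsupport χ ⊆ O := by
    rw [χ.tsupport_eq]
    exact (Metric.closedBall_subset_ball (by change ε / 2 < ε; linarith)).trans
      (hball.trans inter_subset_left)
  set O' := Metric.ball x (ε / 3) with hO'
  have hO'O : O' ⊆ O ∩ U := (Metric.ball_subset_ball (by linarith)).trans hball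
  have hχ1 : ∀ y ∈ O', χ y = 1 := fun y hy =>
    χ.one_of_mem_closedBall (Metric.ball_subset_closedBall hy)
  have hxO' : x ∈ O' := Metric.mem_ball_self (by positivity)
  have ha' : ∀ I, ContDiffOn ℝ ∞ (fun y => χ y * a I y) (halfSpace n) := by
    intro I y hy
    by_cases hys : y ∈ tsupport χ
    · have h1 : ContDiffWithinAt ℝ ∞ (a I) (halfSpace n) y := by
        have h2 := ha I y ⟨hχO hys, hy⟩
        rw [inter_comm] at h2
        exact (contDiffWithinAt_inter (hO.mem_nhds (hχO hys))).1 h2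
      exact χ.contDiff.contDiffAt.contDiffWithinAt.mul h1
    · refine ContDiffWithinAt.congr_of_eventuallyEq (contDiffWithinAt_const (c := (0 : ℝ))) ?_ ?_
      · filter_upwards [nhdsWithin_le_nhds (notMem_tsupport_iff_eventuallyEq.1 hys)] with z hz
        simp [hz]
      · simp [image_eq_zero_of_notMem_tsupport hys]
  have heq : ∀ I J, EqOn (iterD J (fun y => χ y * a I y)) (iterD J (a I)) (O' ∩ halfSpace n) :=
    fun I J => iterD_congr J Metric.isOpen_ball fun y hy => by simp [hχ1 y hy.1]
  obtain ⟨h1, h2⟩ := euler_of_variation ha' (O := O') Metric.isOpen_ball (by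
    intro φ hφ hφc hφO
    rw [← hvarU φ hφ hφc (hφO.trans (hO'O.trans inter_subset_right))]
    refine Finset.sum_congr rfl fun I _ => ?_
    congr 1
    ext y
    by_cases hy : y ∈ tsupport φ
    · rw [hχ1 y (hφO hy), one_mul]
    · rw [image_eq_zero_of_notMem_tsupport (f := iterD _ _)
        fun h => hy (tsupport_iterD_subset _ _ h)]
      simp)
  refine ⟨?_, fun hx0 α hα => ?_⟩
  · rw [← h1 x ⟨hxO', hx.2⟩]
    exact Finset.sum_congr rfl fun I _ => by rw [heq I _ ⟨hxO', hx.2⟩]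
  · rw [← h2 α hα x hxO' hx0]
    exact Finset.sum_congr rfl fun I _ => by rw [heq I _ ⟨hxO', hx.2⟩]

end FundamentalLemma

/-! ### The first variation in a chart -/

section FirstVariation

theorem withLast_zero {n : ℕ} [NeZero n] (x : E n) (v : ℝ) : withLast x v 0 = x 0 := by
  have h : (0 : Fin (n + 1)) = Fin.castSucc 0 := by simp
  rw [h]
  simp only [withLast, Fin.snoc_castSucc]

@[simp] theorem withLast_castSucc {n : ℕ} (x : E n) (v : ℝ) (i : Fin n) :
    withLast x v i.castSucc = x i := by
  simp [withLast]

@[simp] theorem withLast_last {n : ℕ} (x : E n) (v : ℝ) : withLast x v (Fin.last n) = v := by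
  simp [withLast]

@[simp] theorem dropLast_withLast {n : ℕ} (x : E n) (v : ℝ) : dropLast (withLast x v) = x := by
  ext i; simp [dropLast]

theorem withLast_dropLast {n : ℕ} (z : E (n + 1)) : withLast (dropLast z) (z (Fin.last n)) = z := by
  ext i
  refine Fin.lastCases ?_ (fun i => ?_) i <;> simp [dropLast]

/-- `withLast` as a linear map. -/
def withLastL (n : ℕ) : E n × ℝ →L[ℝ] E (n + 1) :=
  LinearMap.toContinuousLinearMap
    { toFun := fun q => withLast q.1 q.2
      map_add' := fun p q => by
        ext i; refine Fin.lastCases ?_ (fun i => ?_) i <;> simp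
      map_smul' := fun c q => by
        ext i; refine Fin.lastCases ?_ (fun i => ?_) i <;> simp }

@[simp] theorem withLastL_apply {n : ℕ} (q : E n × ℝ) : withLastL n q = withLast q.1 q.2 := rfl

/-- `dropLast` as a linear map. -/
def dropLastL (n : ℕ) : E (n + 1) →L[ℝ] E n :=
  LinearMap.toContinuousLinearMap
    { toFun := dropLast
      map_add' := fun p q => by ext i; simp [dropLast]
      map_smul' := fun c q => by ext i; simp [dropLast] }

@[simp] theorem dropLastL_apply {n : ℕ} (z : E (n + 1)) : dropLastL n z = dropLast z := rfl

theorem extend_target_eq {N : ℕ} [NeZero N] {Y : Type*} [TopologicalSpace Y]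
    (e : OpenPartialHomeomorph Y (EuclideanHalfSpace N)) :
    ∃ W : Set (E N), IsOpen W ∧ (e.extend (𝓡∂ N)).target = W ∩ {z | 0 ≤ z 0} := by
  refine ⟨(𝓡∂ N).symm ⁻¹' e.target, e.open_target.preimage (𝓡∂ N).continuous_symm, ?_⟩
  rw [e.extend_target, range_modelWithCornersEuclideanHalfSpace]

variable {n : ℕ} [NeZero n] {Y : Type*} [TopologicalSpace Y]

/-- The domain of the coefficient of a Lagrangian in the chart `e`. -/
def jetDomain (r : ℕ) (e : OpenPartialHomeomorph Y (EuclideanHalfSpace (n + 1))) :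
    Set (Jet n r) :=
  {j | withLast j.1 (j.2 (MultiIndex.zero n r)) ∈ (e.extend (𝓡∂ (n + 1))).target}

theorem jetDomain_eq (r : ℕ) (e : OpenPartialHomeomorph Y (EuclideanHalfSpace (n + 1))) :
    ∃ W : Set (Jet n r), IsOpen W ∧ jetDomain r e = (halfSpace n ×ˢ univ) ∩ W := by
  obtain ⟨W, hW, heq⟩ := extend_target_eq e
  refine ⟨(fun j : Jet n r => withLastL n (j.1, j.2 (MultiIndex.zero n r))) ⁻¹' W,
    hW.preimage (by fun_prop), ?_⟩
  ext j
  simp only [jetDomain, heq, mem_ofPred_eq, mem_inter_iff, withLast_zero, mem_prod, mem_univ,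
    and_true, mem_preimage, withLastL_apply, halfSpace]
  exact and_comm

theorem uniqueDiffOn_jetDomain (r : ℕ)
    (e : OpenPartialHomeomorph Y (EuclideanHalfSpace (n + 1))) :
    UniqueDiffOn ℝ (jetDomain r e) := by
  obtain ⟨W, hW, heq⟩ := jetDomain_eq r e
  rw [heq]
  exact (uniqueDiffOn_halfSpace.prod uniqueDiffOn_univ).inter hW

theorem iterD_zero {r : ℕ} (f : E n → ℝ) : iterD (MultiIndex.zero n r).entries f = f := by
  have : (MultiIndex.zero n r).entries = fun _ => 0 := rfl
  rw [this, iterD]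
  simp

theorem jet_mem_jetDomain {r : ℕ}
    {e : OpenPartialHomeomorph Y (EuclideanHalfSpace (n + 1))}
    {f : E n → ℝ} {x : E n} :
    jet r f x ∈ jetDomain r e ↔ withLast x (f x) ∈ (e.extend (𝓡∂ (n + 1))).target := by
  simp only [jetDomain, jet, mem_ofPred_eq, iterD_zero]

variable [ChartedSpace (EuclideanHalfSpace (n + 1)) Y] {r : ℕ}

theorem hasFDerivAt_coeff (lam : Lagrangian n Y r)
    {e : OpenPartialHomeomorph Y (EuclideanHalfSpace (n + 1))}
    (he : e ∈ IsManifold.maximalAtlas (𝓡∂ (n + 1)) ∞ Y) {j : Jet n r} (hj : j ∈ jetDomain r e) :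
    HasFDerivAt (fun c => lam.coeff e (j.1, c))
      ((fderivWithin ℝ (lam.coeff e) (jetDomain r e) j).comp
        (ContinuousLinearMap.inr ℝ (E n) (MultiIndex n r → ℝ))) j.2 := by
  obtain ⟨W, hW, heq⟩ := jetDomain_eq r e
  have h1 := ((lam.smooth e he).differentiableOn (by simp) j hj).hasFDerivWithinAt
  have h2 : HasFDerivAt (fun c : MultiIndex n r → ℝ => (j.1, c))
      (ContinuousLinearMap.inr ℝ (E n) (MultiIndex n r → ℝ)) j.2 :=
    (hasFDerivAt_const j.1 j.2).prodMk (hasFDerivAt_id j.2)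
  have h3 : (fun c : MultiIndex n r → ℝ => (j.1, c)) ⁻¹' jetDomain r e ∈ 𝓝 j.2 := by
    rw [heq] at hj
    have : (fun c : MultiIndex n r → ℝ => (j.1, c)) ⁻¹' W ∈ 𝓝 j.2 :=
      (hW.preimage (by fun_prop)).mem_nhds hj.2
    filter_upwards [this] with c hc
    rw [heq]
    exact ⟨⟨hj.1.1, mem_univ _⟩, hc⟩
  exact (h1.comp j.2 (h2.hasFDerivWithinAt (s := (fun c : MultiIndex n r → ℝ => (j.1, c)) ⁻¹'
    jetDomain r e)) (fun c hc => hc)).hasFDerivAt h3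

theorem dCoeff_eq (lam : Lagrangian n Y r)
    {e : OpenPartialHomeomorph Y (EuclideanHalfSpace (n + 1))}
    (he : e ∈ IsManifold.maximalAtlas (𝓡∂ (n + 1)) ∞ Y) (I : MultiIndex n r) {j : Jet n r}
    (hj : j ∈ jetDomain r e) :
    dCoeff lam e I j
      = fderivWithin ℝ (lam.coeff e) (jetDomain r e) j (0, Pi.single I 1) := by
  rw [dCoeff, (hasFDerivAt_coeff lam he hj).fderiv]
  rfl

theorem contDiffOn_dCoeff (lam : Lagrangian n Y r)
    {e : OpenPartialHomeomorph Y (EuclideanHalfSpace (n + 1))}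
    (he : e ∈ IsManifold.maximalAtlas (𝓡∂ (n + 1)) ∞ Y) (I : MultiIndex n r) :
    ContDiffOn ℝ ∞ (dCoeff lam e I) (jetDomain r e) := by
  refine ContDiffOn.congr ?_ fun j hj => dCoeff_eq lam he I hj
  exact ((lam.smooth e he).fderivWithin (uniqueDiffOn_jetDomain r e) (m := ∞)
    (by simp)).clm_apply contDiffOn_const

theorem hasDerivAt_coeff_line (lam : Lagrangian n Y r)
    {e : OpenPartialHomeomorph Y (EuclideanHalfSpace (n + 1))}
    (he : e ∈ IsManifold.maximalAtlas (𝓡∂ (n + 1)) ∞ Y) (x : E n) (c d : MultiIndex n r → ℝ)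
    (s : ℝ) (hj : (x, c + s • d) ∈ jetDomain r e) :
    HasDerivAt (fun t : ℝ => lam.coeff e (x, c + t • d))
      (∑ I, d I * dCoeff lam e I (x, c + s • d)) s := by
  have h1 := hasFDerivAt_coeff lam he hj
  have h2 : HasDerivAt (fun t : ℝ => c + t • d) d s := by
    simpa using ((hasDerivAt_id s).smul_const d).const_add c
  convert! h1.comp_hasDerivAt s h2 using 1
  have h3 : ∀ I, dCoeff lam e I (x, c + s • d)
      = fderivWithin ℝ (lam.coeff e) (jetDomain r e) (x, c + s • d) (0, Pi.single I 1) :=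
    fun I => dCoeff_eq lam he I hj
  simp only [h3]
  generalize fderivWithin ℝ (lam.coeff e) (jetDomain r e) (x, c + s • d) = T
  have h4 : d = ∑ I, d I • (Pi.single I 1 : MultiIndex n r → ℝ) := by
    simpa using pi_eq_sum_univ' d
  conv_rhs => rw [h4]
  rw [map_sum]
  simp

theorem contDiffOn_jet {f : E n → ℝ} {O : Set (E n)} (hO : IsOpen O)
    (hf : ContDiffOn ℝ ∞ f (O ∩ halfSpace n)) : ContDiffOn ℝ ∞ (jet r f) (O ∩ halfSpace n) :=
  contDiffOn_id.prodMk (contDiffOn_pi.2 fun I => ContDiffOn.iterD hO hf I.entries)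

theorem jet_add_mul {f φ : E n → ℝ} {O : Set (E n)} (hO : IsOpen O)
    (hf : ContDiffOn ℝ ∞ f (O ∩ halfSpace n)) (hφ : ContDiff ℝ ∞ φ) (s : ℝ) {x : E n}
    (hx : x ∈ O ∩ halfSpace n) :
    jet r (fun z => f z + s * φ z) x
      = (x, (jet r f x).2 + s • fun I : MultiIndex n r => iterD I.entries φ x) := by
  refine Prod.ext rfl ?_
  ext I
  exact iterD_add_const_mul I.entries hO hf hφ.contDiffOn s hx

/-- The derivative of the integral of a Lagrangian under a vertical variation `f + s φ` of the
graph, over a compact set. -/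
theorem hasDerivAt_integral_coeff (lam : Lagrangian n Y r)
    {e : OpenPartialHomeomorph Y (EuclideanHalfSpace (n + 1))}
    (he : e ∈ IsManifold.maximalAtlas (𝓡∂ (n + 1)) ∞ Y) {f φ : E n → ℝ} {O : Set (E n)}
    (hO : IsOpen O) (hf : ContDiffOn ℝ ∞ f (O ∩ halfSpace n)) (hφ : ContDiff ℝ ∞ φ)
    {K : Set (E n)} (hK : IsCompact K) (hKO : K ⊆ O ∩ halfSpace n) {ε : ℝ} (hε : 0 < ε)
    (hmem : ∀ s ∈ Icc (-ε) ε, ∀ x ∈ K,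
      withLast x (f x + s * φ x) ∈ (e.extend (𝓡∂ (n + 1))).target) :
    HasDerivAt (fun s => ∫ x in K, lam.coeff e (jet r (fun z => f z + s * φ z) x))
      (∫ x in K, ∑ I, dCoeff lam e I (jet r f x) * iterD I.entries φ x) 0 := by
  set c : E n → MultiIndex n r → ℝ := fun x => (jet r f x).2 with hc
  set d : E n → MultiIndex n r → ℝ := fun x I => iterD I.entries φ x with hd
  have hcK : ContinuousOn c K := ((contDiffOn_jet hO hf).continuousOn.mono hKO).snd
  have hdK : ContinuousOn d K :=
    ((contDiffOn_jet hO (hφ.contDiffOn (s := O ∩ halfSpace n))).continuousOn.mono hKO).snd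
  have hjet : ∀ s, ∀ x ∈ K, jet r (fun z => f z + s * φ z) x = (x, c x + s • d x) :=
    fun s x hx => jet_add_mul hO hf hφ s (hKO hx)
  have hdom : ∀ s ∈ Icc (-ε) ε, ∀ x ∈ K, (x, c x + s • d x) ∈ jetDomain r e := by
    intro s hs x hx
    rw [← hjet s x hx, jet_mem_jetDomain]
    exact hmem s hs x hx
  have hpath : ContinuousOn (fun q : ℝ × E n => (q.2, c q.2 + q.1 • d q.2))
      (Icc (-ε) ε ×ˢ K) := by
    have h1 : ContinuousOn (fun q : ℝ × E n => c q.2) (Icc (-ε) ε ×ˢ K) :=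
      hcK.comp continuousOn_snd fun q hq => hq.2
    have h2 : ContinuousOn (fun q : ℝ × E n => d q.2) (Icc (-ε) ε ×ˢ K) :=
      hdK.comp continuousOn_snd fun q hq => hq.2
    exact continuousOn_snd.prodMk (h1.add (continuousOn_fst.smul h2))
  have hmaps : MapsTo (fun q : ℝ × E n => (q.2, c q.2 + q.1 • d q.2)) (Icc (-ε) ε ×ˢ K)
      (jetDomain r e) := fun q hq => hdom q.1 hq.1 q.2 hq.2
  have hF' : ContinuousOn (fun q : ℝ × E n =>
      ∑ I, d q.2 I * dCoeff lam e I (q.2, c q.2 + q.1 • d q.2)) (Icc (-ε) ε ×ˢ K) := by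
    refine continuousOn_finsetSum _ fun I _ => ContinuousOn.mul ?_ ?_
    · exact (continuousOn_pi.1 hdK I).comp continuousOn_snd fun q hq => hq.2
    · exact (contDiffOn_dCoeff lam he I).continuousOn.comp hpath hmaps
  have hF : ContinuousOn (fun q : ℝ × E n => lam.coeff e (q.2, c q.2 + q.1 • d q.2))
      (Icc (-ε) ε ×ˢ K) := (lam.smooth e he).continuousOn.comp hpath hmaps
  have hslice : ∀ {g : ℝ × E n → ℝ} (_ : ContinuousOn g (Icc (-ε) ε ×ˢ K)), ∀ s ∈ Icc (-ε) ε,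
      ContinuousOn (fun x => g (s, x)) K := fun hg s hs =>
    hg.comp (by fun_prop) fun x hx => ⟨hs, hx⟩
  obtain ⟨B, hB⟩ := (isCompact_Icc.prod hK).exists_bound_of_continuousOn hF'
  have h0 : (0 : ℝ) ∈ Icc (-ε) ε := ⟨by linarith, hε.le⟩
  have key := hasDerivAt_integral_of_dominated_loc_of_deriv_le (μ := volume.restrict K)
    (F := fun s x => lam.coeff e (x, c x + s • d x))
    (F' := fun s x => ∑ I, d x I * dCoeff lam e I (x, c x + s • d x)) (x₀ := (0 : ℝ))
    (s := Icc (-ε) ε) (bound := fun _ => B) (Icc_mem_nhds (by linarith) hε) ?_ ?_ ?_ ?_ ?_ ?_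
  · have h1 := key.2
    have h2 : ∀ s, ∫ x in K, lam.coeff e (x, c x + s • d x)
        = ∫ x in K, lam.coeff e (jet r (fun z => f z + s * φ z) x) := fun s =>
      setIntegral_congr_fun hK.measurableSet fun x hx => by simp only [hjet s x hx]
    simp only [h2] at h1
    have h3 : ∫ x in K, ∑ I, dCoeff lam e I (jet r f x) * iterD I.entries φ x
        = ∫ x in K, ∑ I, d x I * dCoeff lam e I (x, c x + (0 : ℝ) • d x) := by
      refine setIntegral_congr_fun hK.measurableSet fun x hx => ?_
      refine Finset.sum_congr rfl fun I _ => ?_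
      rw [mul_comm, zero_smul ℝ (d x), add_zero]
      rfl
    rw [h3]
    exact h1
  · filter_upwards [Icc_mem_nhds (by linarith : -ε < 0) hε] with s hs
    exact (hslice hF s hs).aestronglyMeasurable hK.measurableSet
  · exact (hslice hF 0 h0).integrableOn_compact hK
  · exact (hslice hF' 0 h0).aestronglyMeasurable hK.measurableSet
  · refine (ae_restrict_iff' hK.measurableSet).2 (ae_of_all _ fun x hx s hs => ?_)
    exact hB (s, x) ⟨hs, hx⟩
  · have : IsFiniteMeasure (volume.restrict K) := ⟨by simpa using hK.measure_lt_top⟩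
    exact integrable_const B
  · refine (ae_restrict_iff' hK.measurableSet).2 (ae_of_all _ fun x hx s hs => ?_)
    exact hasDerivAt_coeff_line lam he x (c x) (d x) s (hdom s hs x hx)

end FirstVariation

/-! ### Diffeomorphisms moving graphs vertically -/

section VerticalFamily

/-- A small multiple of a compactly supported smooth displacement is a diffeomorphism. -/
theorem exists_homeomorph_add_smul {N : ℕ} {χ : E N → ℝ} (hχ : ContDiff ℝ ∞ χ)
    (hc : HasCompactSupport χ) (v : E N) :
    ∃ ε : ℝ, 0 < ε ∧ ∀ s : ℝ, |s| ≤ ε → ∃ A : E N ≃ₜ E N,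
      (∀ z, A z = z + (s * χ z) • v) ∧ ContDiff ℝ ∞ A.symm := by
  obtain ⟨C, hC⟩ := hχ.lipschitzWith_of_hasCompactSupport hc (by simp)
  have hpos : 0 < 2 * (C * ‖v‖ + 1) := by positivity
  refine ⟨(2 * (C * ‖v‖ + 1))⁻¹, by positivity, fun s hs => ?_⟩
  have hsmall : |s| * (C * ‖v‖) ≤ 1 / 2 := by
    have h1 : |s| * (2 * (C * ‖v‖ + 1)) ≤ 1 := by
      rwa [← le_div_iff₀ hpos, one_div]
    have := abs_nonneg s
    linarith
  set g : E N → E N := fun z => z + (s * χ z) • v with hg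
  have happ : ApproximatesLinearOn g ((ContinuousLinearEquiv.refl ℝ (E N) : E N →L[ℝ] E N))
      univ (1 / 2 : NNReal) := by
    intro x _ y _
    have h1 : g x - g y - (ContinuousLinearEquiv.refl ℝ (E N) : E N →L[ℝ] E N) (x - y)
        = (s * (χ x - χ y)) • v := by
      simp only [hg, ContinuousLinearEquiv.coe_refl, ContinuousLinearMap.id_apply]
      module
    have h2 : |χ x - χ y| ≤ C * ‖x - y‖ := by
      simpa [dist_eq_norm] using hC.dist_le_mul x y
    rw [h1, norm_smul, Real.norm_eq_abs, abs_mul]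
    calc |s| * |χ x - χ y| * ‖v‖ ≤ |s| * (C * ‖x - y‖) * ‖v‖ := by gcongr
      _ = |s| * (C * ‖v‖) * ‖x - y‖ := by ring
      _ ≤ 1 / 2 * ‖x - y‖ := by gcongr
      _ = ((1 / 2 : NNReal) : ℝ) * ‖x - y‖ := by norm_num
  have hc' : Subsingleton (E N) ∨ (1 / 2 : NNReal) <
      ‖((ContinuousLinearEquiv.refl ℝ (E N)).symm : E N →L[ℝ] E N)‖₊⁻¹ := by
    rcases subsingleton_or_nontrivial (E N) with h | h
    · exact Or.inl h
    · right
      have : ‖((ContinuousLinearEquiv.refl ℝ (E N)).symm : E N →L[ℝ] E N)‖₊ = 1 := by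
        ext
        exact ContinuousLinearMap.norm_id
      rw [this, inv_one]
      exact NNReal.half_lt_self one_ne_zero
  have hgs : ContDiff ℝ ∞ g := by fun_prop
  refine ⟨happ.toHomeomorph _ hc', fun z => rfl, ?_⟩
  -- the derivative of `g` differs from the identity by at most `1 / 2`, hence it is injective
  have hder : ∀ z, HasFDerivAt g (ContinuousLinearMap.id ℝ (E N)
      + (s • fderiv ℝ χ z).smulRight v) z := fun z =>
    (hasFDerivAt_id z).add
      ((((hχ.differentiable (by simp)) z).hasFDerivAt.const_mul s).smul_const v)
  have hinj : ∀ z, Function.Injective (ContinuousLinearMap.id ℝ (E N)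
      + (s • fderiv ℝ χ z).smulRight v : E N →L[ℝ] E N) := by
    intro z
    rw [injective_iff_map_eq_zero]
    intro w hw
    have h1 : w = -((s * fderiv ℝ χ z w) • v) := by
      have : w + (s * fderiv ℝ χ z w) • v = 0 := by simpa using hw
      exact eq_neg_of_add_eq_zero_left this
    have h2 : ‖fderiv ℝ χ z‖ ≤ C := norm_fderiv_le_of_lipschitz ℝ hC
    have h3 : ‖w‖ ≤ 1 / 2 * ‖w‖ := by
      calc ‖w‖ = |s| * |fderiv ℝ χ z w| * ‖v‖ := by
            conv_lhs => rw [h1]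
            rw [norm_neg, norm_smul, Real.norm_eq_abs, abs_mul]
        _ ≤ |s| * (C * ‖w‖) * ‖v‖ := by
            gcongr
            exact ((fderiv ℝ χ z).le_opNorm w).trans (by gcongr)
        _ = |s| * (C * ‖v‖) * ‖w‖ := by ring
        _ ≤ 1 / 2 * ‖w‖ := by gcongr
    have := norm_nonneg w
    exact norm_eq_zero.1 (by linarith)
  refine Homeomorph.contDiff_symm _ (f₀' := fun z =>
    (LinearEquiv.ofInjectiveEndo _ (hinj z)).toContinuousLinearEquiv) (fun z => ?_) hgs
  convert! hder z using 1

variable {n : ℕ} {Y : Type*} [TopologicalSpace Y]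

open Classical in
/-- The map of `Y` that is `A` in the chart `e` and the identity outside of the domain of `e`. -/
def chartMap (e : OpenPartialHomeomorph Y (EuclideanHalfSpace (n + 1)))
    (A : E (n + 1) → E (n + 1)) (p : Y) : Y :=
  if p ∈ e.source then (e.extend (𝓡∂ (n + 1))).symm (A (e.extend (𝓡∂ (n + 1)) p)) else p

theorem chartMap_chartMap (e : OpenPartialHomeomorph Y (EuclideanHalfSpace (n + 1)))
    {A B : E (n + 1) → E (n + 1)}
    (hA : MapsTo A (e.extend (𝓡∂ (n + 1))).target (e.extend (𝓡∂ (n + 1))).target)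
    (hBA : ∀ z, B (A z) = z) (p : Y) : chartMap e B (chartMap e A p) = p := by
  by_cases hp : p ∈ e.source
  · have h1 : e.extend (𝓡∂ (n + 1)) p ∈ (e.extend (𝓡∂ (n + 1))).target :=
      (e.extend (𝓡∂ (n + 1))).map_source (by rwa [e.extend_source])
    have h2 := (e.extend (𝓡∂ (n + 1))).map_target (hA h1)
    rw [e.extend_source] at h2
    have h3 : chartMap e A p = (e.extend (𝓡∂ (n + 1))).symm (A (e.extend (𝓡∂ (n + 1)) p)) :=
      if_pos hp
    rw [h3, chartMap, if_pos h2, (e.extend (𝓡∂ (n + 1))).right_inv (hA h1), hBA]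
    exact (e.extend (𝓡∂ (n + 1))).left_inv (by rwa [e.extend_source])
  · have h3 : chartMap e A p = p := if_neg hp
    rw [h3, chartMap, if_neg hp]

theorem chartMap_symm (e : OpenPartialHomeomorph Y (EuclideanHalfSpace (n + 1)))
    (A : E (n + 1) → E (n + 1)) {z : E (n + 1)} (hz : z ∈ (e.extend (𝓡∂ (n + 1))).target) :
    chartMap e A ((e.extend (𝓡∂ (n + 1))).symm z) = (e.extend (𝓡∂ (n + 1))).symm (A z) := by
  have h2 := (e.extend (𝓡∂ (n + 1))).map_target hz
  rw [e.extend_source] at h2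
  rw [chartMap, if_pos h2, (e.extend (𝓡∂ (n + 1))).right_inv hz]

theorem chartMap_eq_self (e : OpenPartialHomeomorph Y (EuclideanHalfSpace (n + 1)))
    {A : E (n + 1) → E (n + 1)} {C : Set (E (n + 1))} (hA : ∀ z ∉ C, A z = z) {p : Y}
    (hp : p ∉ (e.extend (𝓡∂ (n + 1))).symm '' C) : chartMap e A p = p := by
  by_cases hps : p ∈ e.source
  · have h0 : (e.extend (𝓡∂ (n + 1))).symm (e.extend (𝓡∂ (n + 1)) p) = p :=
      (e.extend (𝓡∂ (n + 1))).left_inv (by rwa [e.extend_source])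
    rw [chartMap, if_pos hps, hA, h0]
    exact fun h => hp ⟨_, h, h0⟩
  · rw [chartMap, if_neg hps]

theorem isCompact_image_extend_symm (e : OpenPartialHomeomorph Y (EuclideanHalfSpace (n + 1)))
    {C : Set (E (n + 1))} (hC : IsCompact C) (hCt : C ⊆ (e.extend (𝓡∂ (n + 1))).target) :
    IsCompact ((e.extend (𝓡∂ (n + 1))).symm '' C) :=
  hC.image_of_continuousOn ((e.continuousOn_extend_symm (I := 𝓡∂ (n + 1))).mono hCt)

variable [T2Space Y] [ChartedSpace (EuclideanHalfSpace (n + 1)) Y]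

theorem contMDiff_chartMap {e : OpenPartialHomeomorph Y (EuclideanHalfSpace (n + 1))}
    (he : e ∈ IsManifold.maximalAtlas (𝓡∂ (n + 1)) ∞ Y) {A : ℝ → E (n + 1) → E (n + 1)}
    (hA : ContDiff ℝ ∞ fun q : ℝ × E (n + 1) => A q.1 q.2) {C : Set (E (n + 1))}
    (hC : IsCompact C) (hCt : C ⊆ (e.extend (𝓡∂ (n + 1))).target)
    (hmaps : ∀ t, MapsTo (A t) (e.extend (𝓡∂ (n + 1))).target (e.extend (𝓡∂ (n + 1))).target)
    (hAC : ∀ t, ∀ z ∈ (e.extend (𝓡∂ (n + 1))).target, z ∉ C → A t z = z) :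
    ContMDiff (𝓘(ℝ, ℝ).prod (𝓡∂ (n + 1))) (𝓡∂ (n + 1)) ∞
      (fun q : ℝ × Y => chartMap e (A q.1) q.2) := by
  rintro ⟨t₀, p₀⟩
  by_cases hp : p₀ ∈ e.source
  · have hopen : IsOpen ((univ : Set ℝ) ×ˢ e.source) := isOpen_univ.prod e.open_source
    have h1 : ContMDiffOn (𝓘(ℝ, ℝ).prod (𝓡∂ (n + 1))) 𝓘(ℝ, E (n + 1)) ∞
        (fun q : ℝ × Y => e.extend (𝓡∂ (n + 1)) q.2) ((univ : Set ℝ) ×ˢ e.source) :=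
      (e.contMDiffOn_extend he).comp contMDiffOn_snd fun q hq => hq.2
    have h2 : ContMDiffOn (𝓘(ℝ, ℝ).prod (𝓡∂ (n + 1))) 𝓘(ℝ, ℝ × E (n + 1)) ∞
        (fun q : ℝ × Y => (q.1, e.extend (𝓡∂ (n + 1)) q.2)) ((univ : Set ℝ) ×ˢ e.source) :=
      contMDiffOn_fst.prodMk_space h1
    have h3 := hA.contMDiff.comp_contMDiffOn h2
    have h4 : ContMDiffOn (𝓘(ℝ, ℝ).prod (𝓡∂ (n + 1))) (𝓡∂ (n + 1)) ∞
        (fun q : ℝ × Y => (e.extend (𝓡∂ (n + 1))).symm (A q.1 (e.extend (𝓡∂ (n + 1)) q.2)))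
        ((univ : Set ℝ) ×ˢ e.source) := by
      refine (contMDiffOn_extend_symm he).comp h3 fun q hq => ?_
      have h5 : e.extend (𝓡∂ (n + 1)) q.2 ∈ (e.extend (𝓡∂ (n + 1))).target :=
        (e.extend (𝓡∂ (n + 1))).map_source (by rw [e.extend_source]; exact hq.2)
      have h6 := hmaps q.1 h5
      rwa [e.extend_target, ← (𝓡∂ (n + 1)).image_eq] at h6
    refine ((h4 (t₀, p₀) ⟨mem_univ _, hp⟩).contMDiffAt
      (hopen.mem_nhds ⟨mem_univ _, hp⟩)).congr_of_eventuallyEq ?_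
    filter_upwards [hopen.mem_nhds (show (t₀, p₀) ∈ univ ×ˢ e.source from ⟨mem_univ t₀, hp⟩)] with q hq
    rw [chartMap, if_pos hq.2]
  · have hK := (isCompact_image_extend_symm e hC hCt).isClosed
    have hpK : p₀ ∉ (e.extend (𝓡∂ (n + 1))).symm '' C := by
      rintro ⟨z, hz, rfl⟩
      have := (e.extend (𝓡∂ (n + 1))).map_target (hCt hz)
      rw [e.extend_source] at this
      exact hp this
    have hnh : ((univ : Set ℝ) ×ˢ ((e.extend (𝓡∂ (n + 1))).symm '' C)ᶜ) ∈ 𝓝 (t₀, p₀) :=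
      (isOpen_univ.prod hK.isOpen_compl).mem_nhds ⟨mem_univ _, hpK⟩
    refine contMDiffAt_snd.congr_of_eventuallyEq ?_
    filter_upwards [hnh] with q hq
    by_cases hqs : q.2 ∈ e.source
    · have h0 : (e.extend (𝓡∂ (n + 1))).symm (e.extend (𝓡∂ (n + 1)) q.2) = q.2 :=
        (e.extend (𝓡∂ (n + 1))).left_inv (by rwa [e.extend_source])
      rw [chartMap, if_pos hqs, hAC, h0]
      · exact (e.extend (𝓡∂ (n + 1))).map_source (by rwa [e.extend_source])
      · exact fun h => hq.2 ⟨_, h, h0⟩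
    · rw [chartMap, if_neg hqs]

/-- A smooth family of diffeomorphisms of `Y`, supported in a chart, that moves the points
vertically with initial velocity proportional to a given function `χ`. The
parameter enters through `sin`, so that the family is defined for all times although only small
displacements are diffeomorphisms. -/
theorem exists_vertical_family [NeZero n]
    {e : OpenPartialHomeomorph Y (EuclideanHalfSpace (n + 1))}
    (he : e ∈ IsManifold.maximalAtlas (𝓡∂ (n + 1)) ∞ Y) {χ : E (n + 1) → ℝ}
    (hχ : ContDiff ℝ ∞ χ) (hc : HasCompactSupport χ)
    (hsub : tsupport χ ∩ {z | 0 ≤ z 0} ⊆ (e.extend (𝓡∂ (n + 1))).target) :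
    ∃ ε : ℝ, 0 < ε ∧ ∃ Φ : ℝ → Diffeomorph (𝓡∂ (n + 1)) (𝓡∂ (n + 1)) Y Y ∞,
      ContMDiff (𝓘(ℝ, ℝ).prod (𝓡∂ (n + 1))) (𝓡∂ (n + 1)) ∞ (fun q : ℝ × Y => Φ q.1 q.2) ∧
      (∀ p, Φ 0 p = p) ∧
      (∀ t, ∀ p ∉ (e.extend (𝓡∂ (n + 1))).symm '' (tsupport χ ∩ {z | 0 ≤ z 0}), Φ t p = p) ∧
      ∀ t, ∀ x u, withLast x u ∈ (e.extend (𝓡∂ (n + 1))).target →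
        withLast x (u + ε * Real.sin t * χ (withLast x u)) ∈ (e.extend (𝓡∂ (n + 1))).target ∧
        Φ t ((e.extend (𝓡∂ (n + 1))).symm (withLast x u)) =
          (e.extend (𝓡∂ (n + 1))).symm (withLast x (u + ε * Real.sin t * χ (withLast x u))) := by
  set v : E (n + 1) := withLast 0 1 with hv
  obtain ⟨ε, hε, hA⟩ := exists_homeomorph_add_smul hχ hc v
  have hsin : ∀ t, |ε * Real.sin t| ≤ ε := fun t => by
    rw [abs_mul, abs_of_pos hε]
    exact mul_le_of_le_one_right hε.le (Real.abs_sin_le_one t)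
  choose A hAz hAs using fun t => hA (ε * Real.sin t) (hsin t)
  set T := (e.extend (𝓡∂ (n + 1))).target with hT
  set C := tsupport χ ∩ {z : E (n + 1) | 0 ≤ z 0} with hC
  have hCc : IsCompact C := hc.isCompact.inter_right
    (isClosed_le continuous_const (by fun_prop))
  have hv0 : v 0 = 0 := by rw [hv, withLast_zero]; rfl
  have hA0 : ∀ t z, A t z 0 = z 0 := fun t z => by simp [hAz, hv0]
  have hAoff : ∀ t, ∀ z ∉ tsupport χ, A t z = z := fun t z hz => by
    simp [hAz, image_eq_zero_of_notMem_tsupport hz]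
  have hsoff : ∀ t, ∀ z ∉ tsupport χ, (A t).symm z = z := fun t z hz => by
    rw [Homeomorph.symm_apply_eq, hAoff t z hz]
  have hT0 : ∀ z ∈ T, 0 ≤ z 0 := fun z hz => by
    obtain ⟨W, _, hW⟩ := extend_target_eq e
    rw [hT, hW] at hz
    exact hz.2
  have hmA : ∀ t, MapsTo (A t) T T := by
    intro t z hz
    by_cases h : A t z ∈ tsupport χ
    · exact hsub ⟨h, by simpa only [mem_ofPred_eq, hA0] using hT0 z hz⟩
    · have : A t z = z := (A t).injective (hAoff t _ h)
      rwa [this]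
  have hmS : ∀ t, MapsTo (A t).symm T T := by
    intro t z hz
    by_cases h : (A t).symm z ∈ tsupport χ
    · refine hsub ⟨h, ?_⟩
      have := hA0 t ((A t).symm z)
      rw [Homeomorph.apply_symm_apply] at this
      simpa only [mem_ofPred_eq, ← this] using hT0 z hz
    · have : (A t).symm z = z := by
        have := hAoff t _ h
        rw [Homeomorph.apply_symm_apply] at this
        exact this.symm
      rwa [this]
  have hAC : ∀ t, ∀ z ∈ T, z ∉ C → A t z = z := fun t z hz hzC =>
    hAoff t z fun h => hzC ⟨h, hT0 z hz⟩
  have hSC : ∀ t, ∀ z ∈ T, z ∉ C → (A t).symm z = z := fun t z hz hzC =>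
    hsoff t z fun h => hzC ⟨h, hT0 z hz⟩
  have hAsm : ContDiff ℝ ∞ fun q : ℝ × E (n + 1) => A q.1 q.2 := by
    simp only [hAz]
    have := Real.contDiff_sin (n := ∞)
    fun_prop
  have hjoint := contMDiff_chartMap he (A := fun t => A t) hAsm hCc hsub hmA hAC
  have hslice : ∀ t : ℝ, ContMDiff (𝓡∂ (n + 1)) (𝓘(ℝ, ℝ).prod (𝓡∂ (n + 1))) ∞
      (fun p : Y => (t, p)) := fun t => contMDiff_const.prodMk contMDiff_id
  let Φ : ℝ → Diffeomorph (𝓡∂ (n + 1)) (𝓡∂ (n + 1)) Y Y ∞ := fun t =>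
    { toFun := chartMap e (A t)
      invFun := chartMap e (A t).symm
      left_inv := chartMap_chartMap e (hmA t) (A t).symm_apply_apply
      right_inv := chartMap_chartMap e (hmS t) (A t).apply_symm_apply
      contMDiff_toFun := hjoint.comp (hslice t)
      contMDiff_invFun := (contMDiff_chartMap he (A := fun _ => (A t).symm)
        ((hAs t).comp contDiff_snd) hCc hsub (fun _ => hmS t) (fun _ => hSC t)).comp (hslice 0) }
  have hval : ∀ t p, Φ t p = chartMap e (A t) p := fun _ _ => rfl
  refine ⟨ε, hε, Φ, hjoint, fun p => ?_, fun t p hp => ?_, fun t x u hxu => ?_⟩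
  · rw [hval]
    exact chartMap_eq_self e (C := ∅) (fun z _ => by simp [hAz]) (by simp)
  · rw [hval]
    by_cases hps : p ∈ e.source
    · have h0 : (e.extend (𝓡∂ (n + 1))).symm (e.extend (𝓡∂ (n + 1)) p) = p :=
        (e.extend (𝓡∂ (n + 1))).left_inv (by rwa [e.extend_source])
      rw [chartMap, if_pos hps, hAC, h0]
      · exact (e.extend (𝓡∂ (n + 1))).map_source (by rwa [e.extend_source])
      · exact fun h => hp ⟨_, h, h0⟩
    · rw [chartMap, if_neg hps]
  · have h1 : A t (withLast x u) = withLast x (u + ε * Real.sin t * χ (withLast x u)) := by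
      rw [hAz, hv]
      ext i
      refine Fin.lastCases ?_ (fun i => ?_) i <;> simp
    rw [hval, chartMap_symm e _ hxu, h1]
    exact ⟨h1 ▸ hmA t hxu, rfl⟩

end VerticalFamily

/-! ### Charts in which a submanifold is a graph -/

section GraphCharts

/-- In every chart of the maximal atlas, the boundary is given by `x₀ = 0`. -/
theorem mem_boundary_iff {N : ℕ} [NeZero N] {M : Type*} [TopologicalSpace M]
    [ChartedSpace (EuclideanHalfSpace N) M] [IsManifold (𝓡∂ N) ∞ M]
    {e : OpenPartialHomeomorph M (EuclideanHalfSpace N)}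
    (he : e ∈ IsManifold.maximalAtlas (𝓡∂ N) ∞ M) {p : M} (hp : p ∈ e.source) :
    p ∈ (𝓡∂ N).boundary M ↔ e.extend (𝓡∂ N) p 0 = 0 := by
  let Φ : PartialDiffeomorph (𝓡∂ N) (𝓡∂ N) M (EuclideanHalfSpace N) ∞ :=
    { e.toPartialEquiv with
      open_source := e.open_source
      open_target := e.open_target
      contMDiffOn_toFun := contMDiffOn_of_mem_maximalAtlas he
      contMDiffOn_invFun := contMDiffOn_symm_of_mem_maximalAtlas he }
  have h : IsLocalDiffeomorphAt (𝓡∂ N) (𝓡∂ N) ∞ e p := ⟨Φ, hp, fun _ _ => rfl⟩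
  change (𝓡∂ N).IsBoundaryPoint p ↔ _
  rw [h.isBoundaryPoint_iff (by simp), ModelWithCorners.isBoundaryPoint_iff,
    frontier_range_modelWithCornersEuclideanHalfSpace]
  exact eq_comm

theorem extend_apply_zero_nonneg {N : ℕ} [NeZero N] {M : Type*} [TopologicalSpace M]
    (e : OpenPartialHomeomorph M (EuclideanHalfSpace N)) (p : M) :
    0 ≤ e.extend (𝓡∂ N) p 0 := (e p).2

/-- Composition of a chart with a linear automorphism `A`, on an open set `W` on which `A` respects
the half-space. -/
theorem exists_chart_trans {N : ℕ} [NeZero N] {M : Type*} [TopologicalSpace M]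
    [ChartedSpace (EuclideanHalfSpace N) M] [IsManifold (𝓡∂ N) ∞ M]
    {e : OpenPartialHomeomorph M (EuclideanHalfSpace N)}
    (he : e ∈ IsManifold.maximalAtlas (𝓡∂ N) ∞ M) (A : E N ≃L[ℝ] E N) {W : Set (E N)}
    (hW : IsOpen W) (hWA : ∀ z ∈ W, 0 ≤ z 0 ↔ 0 ≤ A z 0) :
    ∃ e' ∈ IsManifold.maximalAtlas (𝓡∂ N) ∞ M,
      e'.source = e.source ∩ e.extend (𝓡∂ N) ⁻¹' W ∧
      ∀ p ∈ e'.source, e'.extend (𝓡∂ N) p = A (e.extend (𝓡∂ N) p) := by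
  have hr : ∀ z : E N, 0 ≤ z 0 → (𝓡∂ N) ((𝓡∂ N).symm z) = z := fun z hz =>
    (𝓡∂ N).right_inv (by rwa [range_modelWithCornersEuclideanHalfSpace])
  have h1 : ∀ y : EuclideanHalfSpace N, (𝓡∂ N) y ∈ W →
      (𝓡∂ N) ((𝓡∂ N).symm (A ((𝓡∂ N) y))) = A ((𝓡∂ N) y) := fun y hy =>
    hr _ ((hWA _ hy).1 y.2)
  have h2 : ∀ y : EuclideanHalfSpace N, A.symm ((𝓡∂ N) y) ∈ W →
      (𝓡∂ N) ((𝓡∂ N).symm (A.symm ((𝓡∂ N) y))) = A.symm ((𝓡∂ N) y) := fun y hy =>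
    hr _ ((hWA _ hy).2 (by rw [A.apply_symm_apply]; exact y.2))
  let T : OpenPartialHomeomorph (EuclideanHalfSpace N) (EuclideanHalfSpace N) :=
    { toFun := fun y => (𝓡∂ N).symm (A ((𝓡∂ N) y))
      invFun := fun y => (𝓡∂ N).symm (A.symm ((𝓡∂ N) y))
      source := (𝓡∂ N) ⁻¹' W
      target := (fun y => A.symm ((𝓡∂ N) y)) ⁻¹' W
      map_source' := fun y hy => by
        rw [mem_preimage, h1 y hy, A.symm_apply_apply]; exact hy
      map_target' := fun y hy => by
        rw [mem_preimage, h2 y hy]; exact hy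
      left_inv' := fun y hy => by
        rw [h1 y hy, A.symm_apply_apply, (𝓡∂ N).left_inv]
      right_inv' := fun y hy => by
        rw [h2 y hy, A.apply_symm_apply, (𝓡∂ N).left_inv]
      open_source := hW.preimage (𝓡∂ N).continuous
      open_target := hW.preimage (A.symm.continuous.comp (𝓡∂ N).continuous)
      continuousOn_toFun := ((𝓡∂ N).continuous_symm.comp
        (A.continuous.comp (𝓡∂ N).continuous)).continuousOn
      continuousOn_invFun := ((𝓡∂ N).continuous_symm.comp
        (A.symm.continuous.comp (𝓡∂ N).continuous)).continuousOn }
  have hT1 : ContMDiffOn (𝓡∂ N) (𝓡∂ N) ∞ T T.source := by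
    refine (𝓡∂ N).contMDiffOn_symm.comp
      (A.contDiff.contMDiff.comp (𝓡∂ N).contMDiff).contMDiffOn fun y hy => ?_
    rw [range_modelWithCornersEuclideanHalfSpace]
    exact (hWA _ hy).1 y.2
  have hT2 : ContMDiffOn (𝓡∂ N) (𝓡∂ N) ∞ T.symm T.target := by
    refine (𝓡∂ N).contMDiffOn_symm.comp
      (A.symm.contDiff.contMDiff.comp (𝓡∂ N).contMDiff).contMDiffOn fun y hy => ?_
    rw [range_modelWithCornersEuclideanHalfSpace]
    refine (hWA _ hy).2 ?_
    simp only [A.apply_symm_apply]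
    exact y.2
  refine ⟨e.trans T, ?_, ?_, ?_⟩
  · refine OpenPartialHomeomorph.mem_maximalAtlas_of_contMDiffOn _ ?_ ?_
    · exact hT1.comp ((contMDiffOn_of_mem_maximalAtlas he).mono fun p hp => hp.1)
        fun p hp => hp.2
    · exact (contMDiffOn_symm_of_mem_maximalAtlas he).comp
        (hT2.mono fun p hp => hp.1) fun p hp => hp.2
  · rfl
  · intro p hp
    exact h1 (e p) hp.2

/-- `withLast` as a continuous linear equivalence. -/
def withLastEquiv (n : ℕ) : (E n × ℝ) ≃L[ℝ] E (n + 1) :=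
  ContinuousLinearEquiv.equivOfInverse (withLastL n)
    ((dropLastL n).prod (EuclideanSpace.proj (Fin.last n) : E (n + 1) →L[ℝ] ℝ))
    (fun q => by simp) (fun z => by simpa using withLast_dropLast z)

/-- The shear `(x, m) ↦ (x + κ m e₀, m)`. -/
def shearEquiv (n : ℕ) [NeZero n] (κ : ℝ) : (E n × ℝ) ≃L[ℝ] (E n × ℝ) :=
  ContinuousLinearEquiv.equivOfInverse
    ((ContinuousLinearMap.fst ℝ (E n) ℝ + (ContinuousLinearMap.snd ℝ (E n) ℝ).smulRight
      (EuclideanSpace.single 0 κ)).prod (ContinuousLinearMap.snd ℝ (E n) ℝ))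
    ((ContinuousLinearMap.fst ℝ (E n) ℝ - (ContinuousLinearMap.snd ℝ (E n) ℝ).smulRight
      (EuclideanSpace.single 0 κ)).prod (ContinuousLinearMap.snd ℝ (E n) ℝ))
    (fun q => by simp) (fun q => by simp)

theorem shearEquiv_apply {n : ℕ} [NeZero n] (κ : ℝ) (q : E n × ℝ) :
    shearEquiv n κ q = (q.1 + q.2 • EuclideanSpace.single 0 κ, q.2) := rfl

/-- A linear functional that is nonnegative on a half-ball around a boundary point at which it
vanishes is a nonnegative multiple of the boundary coordinate. -/
theorem eq_mul_of_nonneg_on_halfSpace {n : ℕ} [NeZero n] (l : E n →L[ℝ] ℝ) {O : Set (E n)}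
    (hO : IsOpen O) {x : E n} (hx : x ∈ O) (hx0 : x 0 = 0) (hlx : l x = 0)
    (hl : ∀ y ∈ O ∩ {z | 0 ≤ z 0}, 0 ≤ l y) :
    ∃ c : ℝ, 0 ≤ c ∧ ∀ y, l y = c * y 0 := by
  have key : ∀ v : E n, 0 ≤ v 0 → 0 ≤ l v := by
    intro v hv
    have h1 : Tendsto (fun δ : ℝ => x + δ • v) (𝓝[>] 0) (𝓝 x) := by
      have : Continuous fun δ : ℝ => x + δ • v := by fun_prop
      simpa using (this.tendsto 0).mono_left nhdsWithin_le_nhds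
    obtain ⟨δ, hδ, hδ0⟩ := ((h1.eventually_mem (hO.mem_nhds hx)).and self_mem_nhdsWithin).exists
    have hδ' : (0 : ℝ) < δ := hδ0
    have h2 := hl (x + δ • v) ⟨hδ, by simpa [hx0] using mul_nonneg hδ'.le hv⟩
    rw [map_add, hlx, map_smul, zero_add, smul_eq_mul] at h2
    exact nonneg_of_mul_nonneg_right h2 hδ'
  refine ⟨l (EuclideanSpace.single 0 1), key _ (by simp), fun y => ?_⟩
  set w : E n := y - y 0 • EuclideanSpace.single 0 1 with hw
  have hw0 : w 0 = 0 := by simp [hw]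
  have h1 : l w = 0 := by
    refine le_antisymm ?_ (key w hw0.ge)
    have := key (-w) (by simp [hw0])
    rw [map_neg] at this
    linarith
  rw [hw, map_sub, map_smul, smul_eq_mul] at h1
  linarith

variable {n : ℕ} [NeZero n] {Y : Type*} [TopologicalSpace Y]
  [ChartedSpace (EuclideanHalfSpace (n + 1)) Y] [IsManifold (𝓡∂ (n + 1)) ∞ Y]

/-- The local normal form of a submanifold gives a chart in which it is the graph of `0`. The linear
map that straightens the submanifold is sheared so as to preserve the half-space. -/
theorem exists_isGraphOn {S : Set Y} (hS : IsNonTangentSubmanifold (n := n) S) {p : Y}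
    (hp : p ∈ S) :
    ∃ (e : OpenPartialHomeomorph Y (EuclideanHalfSpace (n + 1))) (f : E n → ℝ) (Ω : Set (E n)),
      IsGraphOn S e f Ω ∧ ∃ x ∈ Ω, graphPt e f x = p := by
  obtain ⟨hcs, hman, hemb, hbd, hnt⟩ := hS
  have himm := hemb.isImmersion.isImmersionAt ⟨p, hp⟩
  set φ := himm.domChart with hφ
  set ψ := himm.codChart with hψ
  have hφm := himm.domChart_mem_maximalAtlas
  have hψm := himm.codChart_mem_maximalAtlas
  have hpφ : (⟨p, hp⟩ : S) ∈ φ.source := himm.mem_domChart_source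
  have hpψ : p ∈ ψ.source := himm.mem_codChart_source
  rw [← hφ] at hφm
  rw [← hψ] at hψm
  -- the complement in the local normal form is one-dimensional
  have : FiniteDimensional ℝ himm.complement :=
    Module.Finite.of_surjective ((LinearMap.snd ℝ (E n) himm.complement).comp
      (himm.equiv.symm : E (n + 1) →ₗ[ℝ] _))
      (Prod.snd_surjective.comp himm.equiv.symm.surjective)
  have hrank : Module.finrank ℝ ℝ = Module.finrank ℝ himm.complement := by
    have h1 := himm.equiv.toLinearEquiv.finrank_eq
    rw [Module.finrank_prod, finrank_euclideanSpace_fin, finrank_euclideanSpace_fin] at h1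
    rw [Module.finrank_self]
    omega
  let μ : ℝ ≃L[ℝ] himm.complement := (LinearEquiv.ofFinrankEq _ _ hrank).toContinuousLinearEquiv
  let Q : (E n × ℝ) ≃L[ℝ] E (n + 1) :=
    ((ContinuousLinearEquiv.refl ℝ (E n)).prodCongr μ).trans himm.equiv
  have hQ : ∀ x ∈ (φ.extend (𝓡∂ n)).target,
      ψ.extend (𝓡∂ (n + 1)) ((φ.extend (𝓡∂ n)).symm x : S) = Q (x, 0) := by
    intro x hx
    have h1 := himm.writtenInCharts hx
    have h2 : Q (x, 0) = himm.equiv (x, 0) := by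
      change himm.equiv (x, μ 0) = _
      rw [map_zero]
    rw [h2]
    exact h1
  have hQ' : ∀ q ∈ φ.source, ψ.extend (𝓡∂ (n + 1)) (q : Y) = Q (φ.extend (𝓡∂ n) q, 0) := by
    intro q hq
    rw [← hQ _ ((φ.extend (𝓡∂ n)).map_source (by rwa [φ.extend_source])),
      (φ.extend (𝓡∂ n)).left_inv (by rwa [φ.extend_source])]
  have hsrc : ∀ q ∈ φ.source, (q : Y) ∈ ψ.source := fun q hq =>
    himm.source_subset_preimage_source hq
  obtain ⟨Wφ, hWφ, hWφt⟩ := extend_target_eq φ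
  set x₁ := φ.extend (𝓡∂ n) ⟨p, hp⟩ with hx₁
  have hx₁t : x₁ ∈ (φ.extend (𝓡∂ n)).target :=
    (φ.extend (𝓡∂ n)).map_source (by rwa [φ.extend_source])
  -- it suffices to choose the shear and the domain
  suffices H : ∃ (κ : ℝ) (W : Set (E (n + 1))), IsOpen W ∧ Q (x₁, 0) ∈ W ∧
      ∀ z ∈ W, 0 ≤ z 0 ↔
        0 ≤ (Q.symm.trans ((shearEquiv n κ).trans (withLastEquiv n))) z 0 by
    obtain ⟨κ, W, hW, hxW, hWA⟩ := H
    set A := Q.symm.trans ((shearEquiv n κ).trans (withLastEquiv n)) with hA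
    obtain ⟨e, hem, hes, hee⟩ := exists_chart_trans hψm A hW hWA
    have hAQ : ∀ x, A (Q (x, 0)) = withLast x 0 := by
      intro x
      simp only [hA, ContinuousLinearEquiv.trans_apply, ContinuousLinearEquiv.symm_apply_apply,
        shearEquiv_apply, zero_smul, add_zero]
      rfl
    set Ω : Set (E n) := (φ.extend (𝓡∂ n)).target ∩ {x | Q (x, 0) ∈ W} with hΩ
    have hcontQ : Continuous fun x : E n => Q (x, 0) := by fun_prop
    have hΩe : ∀ x ∈ Ω, ((φ.extend (𝓡∂ n)).symm x : Y) ∈ e.source := by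
      intro x hx
      have h1 := (φ.extend (𝓡∂ n)).map_target hx.1
      rw [φ.extend_source] at h1
      rw [hes]
      refine ⟨hsrc _ h1, ?_⟩
      rw [mem_preimage, hQ x hx.1]
      exact hx.2
    have hval : ∀ x ∈ Ω, e.extend (𝓡∂ (n + 1)) ((φ.extend (𝓡∂ n)).symm x : Y)
        = withLast x 0 := by
      intro x hx
      rw [hee _ (hΩe x hx), hQ x hx.1, hAQ]
    have hgr : ∀ x ∈ Ω, graphPt e (fun _ => 0) x = ((φ.extend (𝓡∂ n)).symm x : Y) := by
      intro x hx
      rw [graphPt, ← hval x hx]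
      exact (e.extend (𝓡∂ (n + 1))).left_inv (by rw [e.extend_source]; exact hΩe x hx)
    refine ⟨e, fun _ => 0, Ω, ⟨hem, ⟨Wφ ∩ {x | Q (x, 0) ∈ W}, hWφ.inter (hW.preimage hcontQ), ?_⟩,
      contDiffOn_const, fun x hx => ?_, ?_⟩, x₁, ⟨hx₁t, hxW⟩, ?_⟩
    · rw [hΩ, hWφt]
      ext x
      simp only [mem_inter_iff, halfSpace]
      tauto
    · rw [← hval x hx]
      exact (e.extend (𝓡∂ (n + 1))).map_source (by rw [e.extend_source]; exact hΩe x hx)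
    · have hU : IsOpen (φ.source ∩ φ.extend (𝓡∂ n) ⁻¹' {x | Q (x, 0) ∈ W}) :=
        φ.isOpen_extend_preimage (hW.preimage hcontQ)
      obtain ⟨V, hV, hVU⟩ := isOpen_induced_iff.1 hU
      refine ⟨V, hV, ?_⟩
      ext y
      constructor
      · rintro ⟨x, hx, rfl⟩
        rw [hgr x hx]
        refine ⟨Subtype.coe_prop _, ?_⟩
        change (φ.extend (𝓡∂ n)).symm x ∈ Subtype.val ⁻¹' V
        rw [hVU]
        have h1 := (φ.extend (𝓡∂ n)).map_target hx.1
        rw [φ.extend_source] at h1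
        refine ⟨h1, ?_⟩
        rw [mem_preimage, (φ.extend (𝓡∂ n)).right_inv hx.1]
        exact hx.2
      · rintro ⟨hyS, hyV⟩
        have h1 : (⟨y, hyS⟩ : S) ∈ Subtype.val ⁻¹' V := hyV
        rw [hVU] at h1
        have h2 : φ.extend (𝓡∂ n) ⟨y, hyS⟩ ∈ Ω :=
          ⟨(φ.extend (𝓡∂ n)).map_source (by rw [φ.extend_source]; exact h1.1), h1.2⟩
        refine ⟨_, h2, ?_⟩
        rw [hgr _ h2, (φ.extend (𝓡∂ n)).left_inv (by rw [φ.extend_source]; exact h1.1)]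
    · rw [hgr x₁ ⟨hx₁t, hxW⟩, hx₁, (φ.extend (𝓡∂ n)).left_inv (by rwa [φ.extend_source])]
  have hA0 : ∀ (κ : ℝ) (x : E n) (m : ℝ),
      (Q.symm.trans ((shearEquiv n κ).trans (withLastEquiv n))) (Q (x, m)) 0 = x 0 + m * κ := by
    intro κ x m
    simp only [ContinuousLinearEquiv.trans_apply, ContinuousLinearEquiv.symm_apply_apply,
      shearEquiv_apply]
    change withLast (x + m • EuclideanSpace.single 0 κ) m 0 = _
    rw [withLast_zero]
    simp
  have hbS : (⟨p, hp⟩ : S) ∈ (𝓡∂ n).boundary S ↔ p ∈ (𝓡∂ (n + 1)).boundary Y := by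
    constructor
    · intro h
      have : p ∈ Subtype.val '' ((𝓡∂ n).boundary S) := ⟨_, h, rfl⟩
      rw [hbd] at this
      exact this.2
    · intro h
      have : p ∈ Subtype.val '' ((𝓡∂ n).boundary S) := by rw [hbd]; exact ⟨hp, h⟩
      obtain ⟨q, hq, hqp⟩ := this
      have : q = ⟨p, hp⟩ := Subtype.ext hqp
      rwa [← this]
  have hQx₁ : Q (x₁, 0) = ψ.extend (𝓡∂ (n + 1)) p := (hQ' _ hpφ).symm
  by_cases hpb : p ∈ (𝓡∂ (n + 1)).boundary Y
  · -- at a boundary point, the boundary coordinate restricts to a positive multiple of `x₀`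
    have hx₁0 : x₁ 0 = 0 := (mem_boundary_iff hφm hpφ).1 (hbS.2 hpb)
    have hl1 : Q (x₁, 0) 0 = 0 := by
      rw [hQx₁]
      exact (mem_boundary_iff hψm hpψ).1 hpb
    let l : E n →L[ℝ] ℝ := (EuclideanSpace.proj (0 : Fin (n + 1)) : E (n + 1) →L[ℝ] ℝ).comp
      ((Q : (E n × ℝ) →L[ℝ] E (n + 1)).comp (ContinuousLinearMap.inl ℝ (E n) ℝ))
    have hlQ : ∀ x, l x = Q (x, 0) 0 := fun x => rfl
    obtain ⟨c, hc, hlc⟩ := eq_mul_of_nonneg_on_halfSpace l hWφ (x := x₁)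
      (by rw [hWφt] at hx₁t; exact hx₁t.1) hx₁0 hl1 (by
        intro y hy
        rw [← hWφt] at hy
        rw [hlQ, ← hQ y hy]
        exact extend_apply_zero_nonneg ψ _)
    have hc0 : c ≠ 0 := by
      rintro rfl
      refine hnt ⟨p, hp⟩ hpb ψ hψm hpψ ?_
      have h1 : (fun q : S => ψ.extend (𝓡∂ (n + 1)) (q : Y) 0) =ᶠ[𝓝 ⟨p, hp⟩] fun _ => 0 := by
        filter_upwards [φ.open_source.mem_nhds hpφ] with q hq
        rw [hQ' q hq, ← hlQ, hlc, zero_mul]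
      rw [h1.mfderiv_eq]
      exact mfderiv_const
    have hcpos : 0 < c := lt_of_le_of_ne hc (Ne.symm hc0)
    refine ⟨Q (0, 1) 0 / c, univ, isOpen_univ, mem_univ _, fun z _ => ?_⟩
    obtain ⟨⟨x, m⟩, rfl⟩ := Q.surjective z
    have h1 : Q (x, m) 0 = c * x 0 + m * Q (0, 1) 0 := by
      have h2 : ((x, m) : E n × ℝ) = (x, 0) + m • (0, 1) := by simp
      rw [h2, map_add, map_smul, ← hlc, hlQ]
      rfl
    have h2 : x 0 + m * (Q (0, 1) 0 / c) = Q (x, m) 0 / c := by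
      rw [h1]; field_simp
    rw [hA0, h2, le_div_iff₀ hcpos, zero_mul]
  · -- at an interior point, it suffices to stay away from the boundary
    have hx₁0 : 0 < x₁ 0 := lt_of_le_of_ne (extend_apply_zero_nonneg φ _) fun h =>
      hpb (hbS.1 ((mem_boundary_iff hφm hpφ).2 h.symm))
    have hψ0 : 0 < Q (x₁, 0) 0 := by
      rw [hQx₁]
      exact lt_of_le_of_ne (extend_apply_zero_nonneg ψ _) fun h =>
        hpb ((mem_boundary_iff hψm hpψ).2 h.symm)
    refine ⟨0, {z | 0 < z 0} ∩
      {z | 0 < (Q.symm.trans ((shearEquiv n 0).trans (withLastEquiv n))) z 0}, ?_, ⟨hψ0, ?_⟩,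
      fun z hz => ⟨fun _ => le_of_lt hz.2, fun _ => le_of_lt hz.1⟩⟩
    · exact (isOpen_lt continuous_const (by fun_prop)).inter
        (isOpen_lt continuous_const (by fun_prop))
    · change 0 < (Q.symm.trans ((shearEquiv n 0).trans (withLastEquiv n))) (Q (x₁, 0)) 0
      rw [hA0]
      simpa using hx₁0

end GraphCharts

/-! ### Graphs, orientations and the action -/

section Action

variable {n : ℕ} [NeZero n] {Y : Type*} [TopologicalSpace Y]
  [ChartedSpace (EuclideanHalfSpace (n + 1)) Y]

namespace IsGraphOn

variable {S : Set Y} {e : OpenPartialHomeomorph Y (EuclideanHalfSpace (n + 1))}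
  {f : E n → ℝ} {Ω : Set (E n)}

theorem extend_graphPt (h : IsGraphOn S e f Ω) {x : E n} (hx : x ∈ Ω) :
    e.extend (𝓡∂ (n + 1)) (graphPt e f x) = withLast x (f x) :=
  (e.extend (𝓡∂ (n + 1))).right_inv (h.mem_target x hx)

theorem graphPt_mem_source (h : IsGraphOn S e f Ω) {x : E n} (hx : x ∈ Ω) :
    graphPt e f x ∈ e.source := by
  have := (e.extend (𝓡∂ (n + 1))).map_target (h.mem_target x hx)
  rwa [e.extend_source] at this

theorem graphPt_mem (h : IsGraphOn S e f Ω) {x : E n} (hx : x ∈ Ω) : graphPt e f x ∈ S := by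
  obtain ⟨V, _, hV⟩ := h.isOpen_image
  exact (hV ▸ mem_image_of_mem _ hx : graphPt e f x ∈ S ∩ V).1

theorem subset_halfSpace (h : IsGraphOn S e f Ω) : Ω ⊆ halfSpace n := by
  obtain ⟨O, _, rfl⟩ := h.isOpen_domain
  exact inter_subset_right

theorem continuousOn_graphPt (h : IsGraphOn S e f Ω) : ContinuousOn (graphPt e f) Ω := by
  refine (e.continuousOn_extend_symm (I := 𝓡∂ (n + 1))).comp ?_ h.mem_target
  exact (withLastL n).continuous.comp_continuousOn
    (continuousOn_id.prodMk h.smooth.continuousOn)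

/-- Restriction of a graph to an open subset of `Y`. -/
theorem restrict (h : IsGraphOn S e f Ω) {V : Set Y} (hV : IsOpen V) :
    IsGraphOn S e f (Ω ∩ graphPt e f ⁻¹' V) := by
  obtain ⟨O, hO, hΩ⟩ := h.isOpen_domain
  obtain ⟨V₀, hV₀, hS⟩ := h.isOpen_image
  refine ⟨h.chart_mem, ?_, h.smooth.mono inter_subset_left, fun x hx => h.mem_target x hx.1,
    V₀ ∩ V, hV₀.inter hV, ?_⟩
  · obtain ⟨O', hO', heq⟩ := continuousOn_iff'.1 h.continuousOn_graphPt V hV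
    refine ⟨O ∩ O', hO.inter hO', ?_⟩
    rw [inter_comm, heq, hΩ]
    ext x
    simp only [mem_inter_iff]
    tauto
  · rw [image_inter_preimage, hS, inter_assoc]

/-- A graph in the image of `S` under a diffeomorphism is a graph in `S`, with respect to the
transported chart. -/
theorem of_image [IsManifold (𝓡∂ (n + 1)) ∞ Y]
    (Φ : Diffeomorph (𝓡∂ (n + 1)) (𝓡∂ (n + 1)) Y Y ∞) (h : IsGraphOn (Φ '' S) e f Ω) :
    IsGraphOn S (Φ.toHomeomorph.toOpenPartialHomeomorph.trans e) f Ω := by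
  obtain ⟨V, hV, himg⟩ := h.isOpen_image
  refine ⟨?_, h.isOpen_domain, h.smooth, fun x hx => ?_, Φ ⁻¹' V, hV.preimage Φ.continuous, ?_⟩
  · refine OpenPartialHomeomorph.mem_maximalAtlas_of_contMDiffOn _ ?_ ?_
    · exact (contMDiffOn_of_mem_maximalAtlas h.chart_mem).comp Φ.contMDiff.contMDiffOn
        fun p hp => hp.2
    · exact Φ.symm.contMDiff.comp_contMDiffOn
        ((contMDiffOn_symm_of_mem_maximalAtlas h.chart_mem).mono fun p hp => hp.1)
  · have h1 := h.mem_target x hx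
    rw [OpenPartialHomeomorph.extend_target] at h1 ⊢
    exact ⟨⟨h1.1, mem_univ _⟩, h1.2⟩
  · have h1 : ∀ x, graphPt (Φ.toHomeomorph.toOpenPartialHomeomorph.trans e) f x
        = Φ.symm (graphPt e f x) := fun x => rfl
    ext p
    constructor
    · rintro ⟨x, hx, rfl⟩
      have h2 : graphPt e f x ∈ Φ '' S ∩ V := himg ▸ mem_image_of_mem _ hx
      obtain ⟨⟨q, hq, hqx⟩, h3⟩ := h2
      rw [h1, ← hqx]
      refine ⟨by rwa [Φ.symm_apply_apply], ?_⟩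
      rw [mem_preimage, Φ.apply_symm_apply, hqx]
      exact h3
    · rintro ⟨hpS, hpV⟩
      have h2 : Φ p ∈ graphPt e f '' Ω := by
        rw [himg]
        exact ⟨mem_image_of_mem _ hpS, hpV⟩
      obtain ⟨x, hx, hxp⟩ := h2
      exact ⟨x, hx, by rw [h1, hxp, Φ.symm_apply_apply]⟩

end IsGraphOn

/-- Two charts in which an oriented set is parametrized by the same independent variables have the
same sign. -/
theorem IsOrientation.sign_eq {L : OrientedSet n Y} (hL : IsOrientation L)
    {e e' : OpenPartialHomeomorph Y (EuclideanHalfSpace (n + 1))} {f f' : E n → ℝ}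
    {Ω : Set (E n)} (h : IsGraphOn L.carrier e f Ω) (h' : IsGraphOn L.carrier e' f' Ω)
    (heq : ∀ x ∈ Ω, e'.extend (𝓡∂ (n + 1)) (graphPt e f x) = withLast x (f' x))
    {x : E n} (hx : x ∈ Ω) (hpt : graphPt e f x = graphPt e' f' x) :
    L.sign e' (graphPt e f x) = L.sign e (graphPt e f x) := by
  have hjac : jacobian e f e' x = 1 := by
    obtain ⟨O, hO, hΩ⟩ := h.isOpen_domain
    have hx' : x ∈ O ∩ halfSpace n := hΩ ▸ hx
    have h1 : EqOn (transition e f e') id (O ∩ halfSpace n) := by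
      intro z hz
      rw [← hΩ] at hz
      rw [transition, heq z hz, dropLast_withLast]
      rfl
    have hu : UniqueDiffWithinAt ℝ (halfSpace n) x := uniqueDiffOn_halfSpace x hx'.2
    rw [jacobian, ← fderivWithin_inter_halfSpace hO hx'.1, fderivWithin_congr h1 (h1 hx'),
      fderivWithin_inter_halfSpace hO hx'.1, fderivWithin_id hu]
    exact LinearMap.det_id
  have h2 := hL.change e e' f f' Ω Ω h h' x hx x hx hpt
  rw [hjac, mul_one] at h2
  rcases Int.units_eq_one_or (L.sign e (graphPt e f x)) with h3 | h3 <;>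
  rcases Int.units_eq_one_or (L.sign e' (graphPt e f x)) with h4 | h4 <;>
  rw [h3, h4] at h2 ⊢ <;> norm_num at h2

/-- The pieces of a cover may be indexed by any finite type. -/
theorem hasAction_of_fintype {r : ℕ} (lam : Lagrangian n Y r) (L : OrientedSet n Y)
    {ι : Type*} [Fintype ι] (e : ι → OpenPartialHomeomorph Y (EuclideanHalfSpace (n + 1)))
    (f : ι → E n → ℝ) (Ω : ι → Set (E n)) (ρ : ι → Y → ℝ)
    (h1 : ∀ i, IsGraphOn L.carrier (e i) (f i) (Ω i)) (h2 : ∀ i, ContinuousOn (ρ i) L.carrier)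
    (h3 : ∀ i, ∃ K : Set (E n), IsCompact K ∧ K ⊆ Ω i ∧
      ∀ p ∈ L.carrier, ρ i p ≠ 0 → p ∈ graphPt (e i) (f i) '' K)
    (h4 : ∀ p ∈ L.carrier, ∑ i, ρ i p = 1) :
    HasAction lam L (∑ i, ∫ x in Ω i, ρ i (graphPt (e i) (f i) x)
      * ((L.sign (e i) (graphPt (e i) (f i) x) : ℤ) : ℝ) * lam.coeff (e i) (jet r (f i) x)) := by
  let g := (Fintype.equivFin ι).symm
  refine ⟨Fintype.card ι, fun j => e (g j), fun j => f (g j), fun j => Ω (g j), fun j => ρ (g j),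
    fun j => h1 _, fun j => h2 _, fun j => h3 _, fun p hp => ?_, ?_⟩
  · rw [← h4 p hp]
    exact g.sum_comp fun i => ρ i p
  · exact (g.sum_comp fun i => ∫ x in Ω i, ρ i (graphPt (e i) (f i) x)
      * ((L.sign (e i) (graphPt (e i) (f i) x) : ℤ) : ℝ) * lam.coeff (e i) (jet r (f i) x)).symm

/-- A cover of a compact submanifold by graphs, together with a partition of unity, in which one
graph is prescribed and the others avoid a given closed set. -/
theorem exists_partition.{u} {n : ℕ} [NeZero n] {Y : Type u} [TopologicalSpace Y] [T2Space Y]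
    [ChartedSpace (EuclideanHalfSpace (n + 1)) Y] [IsManifold (𝓡∂ (n + 1)) ∞ Y] {S : Set Y}
    (hSc : IsCompact S) (hS : IsNonTangentSubmanifold (n := n) S)
    {e₀ : OpenPartialHomeomorph Y (EuclideanHalfSpace (n + 1))} {f₀ : E n → ℝ}
    {Ω₀ : Set (E n)} (h₀ : IsGraphOn S e₀ f₀ Ω₀) {K : Set Y} (hK : IsClosed K)
    (hKS : S ∩ K ⊆ graphPt e₀ f₀ '' Ω₀) :
    ∃ (κ : Type u) (_ : Fintype κ)
      (e : Option κ → OpenPartialHomeomorph Y (EuclideanHalfSpace (n + 1)))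
      (f : Option κ → E n → ℝ) (Ω : Option κ → Set (E n)) (ρ : Option κ → Y → ℝ),
      e none = e₀ ∧ f none = f₀ ∧ Ω none = Ω₀ ∧
      (∀ i, IsGraphOn S (e i) (f i) (Ω i)) ∧ (∀ i, ContinuousOn (ρ i) S) ∧
      (∀ i, ∃ C : Set (E n), IsCompact C ∧ C ⊆ Ω i ∧
        ∀ p ∈ S, ρ i p ≠ 0 → p ∈ graphPt (e i) (f i) '' C) ∧
      (∀ p ∈ S, ∑ i, ρ i p = 1) ∧
      ∀ i : κ, ∀ x ∈ Ω (some i), graphPt (e (some i)) (f (some i)) x ∉ K := by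
  classical
  obtain ⟨V₀, hV₀, himg₀⟩ := h₀.isOpen_image
  -- graphs around the points outside of the prescribed one
  have hloc : ∀ p : ↥(S \ V₀),
      ∃ (e : OpenPartialHomeomorph Y (EuclideanHalfSpace (n + 1))) (f : E n → ℝ)
        (Ω : Set (E n)) (V : Set Y), IsGraphOn S e f Ω ∧ IsOpen V ∧ (p : Y) ∈ V ∧
        graphPt e f '' Ω = S ∩ V ∧ ∀ x ∈ Ω, graphPt e f x ∉ K := by
    intro p
    obtain ⟨e, f, Ω, h, x, hx, hxp⟩ := exists_isGraphOn hS p.2.1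
    have hpK : (p : Y) ∈ Kᶜ := fun hpK =>
      p.2.2 (himg₀ ▸ hKS ⟨p.2.1, hpK⟩ : (p : Y) ∈ S ∩ V₀).2
    have h' := h.restrict hK.isOpen_compl
    obtain ⟨V, hV, himg⟩ := h'.isOpen_image
    refine ⟨e, f, _, V, h', hV, ?_, himg, fun x hx => hx.2⟩
    have : (p : Y) ∈ S ∩ V := by
      rw [← himg]
      exact ⟨x, ⟨hx, by rw [mem_preimage, hxp]; exact hpK⟩, hxp⟩
    exact this.2
  choose e f Ω V hgr hVo hpV himg hoff using hloc
  obtain ⟨t, ht⟩ := (hSc.diff hV₀).elim_nhds_subcover' (fun p hp => V ⟨p, hp⟩)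
    fun p hp => (hVo _).mem_nhds (hpV ⟨p, hp⟩)
  let e' : Option ↥t → OpenPartialHomeomorph Y (EuclideanHalfSpace (n + 1)) := fun i =>
    i.elim e₀ fun p => e p
  let f' : Option ↥t → E n → ℝ := fun i => i.elim f₀ fun p => f p
  let Ω' : Option ↥t → Set (E n) := fun i => i.elim Ω₀ fun p => Ω p
  let V' : Option ↥t → Set Y := fun i => i.elim V₀ fun p => V p
  have hgr' : ∀ i, IsGraphOn S (e' i) (f' i) (Ω' i) := by
    rintro (_ | p)
    · exact h₀
    · exact hgr p
  have hV' : ∀ i, IsOpen (V' i) := by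
    rintro (_ | p)
    · exact hV₀
    · exact hVo p
  have himg' : ∀ i, graphPt (e' i) (f' i) '' Ω' i = S ∩ V' i := by
    rintro (_ | p)
    · exact himg₀
    · exact himg p
  have : CompactSpace S := isCompact_iff_compactSpace.1 hSc
  obtain ⟨g, hg⟩ := PartitionOfUnity.exists_isSubordinate (X := S) isClosed_univ
    (fun i => Subtype.val ⁻¹' V' i) (fun i => (hV' i).preimage continuous_subtype_val) (by
      rintro ⟨p, hp⟩ -
      by_cases hpV₀ : p ∈ V₀
      · exact mem_iUnion.2 ⟨none, hpV₀⟩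
      · obtain ⟨q, hq, hpq⟩ := mem_iUnion₂.1 (ht ⟨hp, hpV₀⟩)
        exact mem_iUnion.2 ⟨some ⟨q, hq⟩, hpq⟩)
  let ρ : Option ↥t → Y → ℝ := fun i p => if h : p ∈ S then g i ⟨p, h⟩ else 0
  have hρ : ∀ i p (h : p ∈ S), ρ i p = g i ⟨p, h⟩ := fun i p h => dif_pos h
  refine ⟨↥t, inferInstance, e', f', Ω', ρ, rfl, rfl, rfl, hgr', fun i => ?_, fun i => ?_,
    fun p hp => ?_, fun i x hx => hoff i x hx⟩
  · rw [continuousOn_iff_continuous_domRestrict]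
    refine (g i).continuous.congr fun p => ?_
    exact (hρ i p p.2).symm
  · have hsub : ∀ q ∈ tsupport (g i), ∃ x ∈ Ω' i, graphPt (e' i) (f' i) x = (q : Y) :=
      fun q hq => by
        have : (q : Y) ∈ S ∩ V' i := ⟨q.2, hg i hq⟩
        rwa [← himg' i] at this
    have hinv : ∀ x ∈ Ω' i,
        dropLast ((e' i).extend (𝓡∂ (n + 1)) (graphPt (e' i) (f' i) x)) = x := fun x hx => by
      rw [(hgr' i).extend_graphPt hx, dropLast_withLast]
    refine ⟨(fun q : S => dropLast ((e' i).extend (𝓡∂ (n + 1)) (q : Y))) '' tsupport (g i),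
      (isClosed_tsupport _).isCompact.image_of_continuousOn ?_, ?_, fun p hp hne => ?_⟩
    · refine (dropLastL n).continuous.comp_continuousOn
        (((e' i).continuousOn_extend (I := 𝓡∂ (n + 1))).comp
          continuous_subtype_val.continuousOn fun q hq => ?_)
      obtain ⟨x, hx, hxq⟩ := hsub q hq
      rw [(e' i).extend_source, ← hxq]
      exact (hgr' i).graphPt_mem_source hx
    · rintro _ ⟨q, hq, rfl⟩
      obtain ⟨x, hx, hxq⟩ := hsub q hq
      simp only
      rw [← hxq, hinv x hx]
      exact hx
    · rw [hρ i p hp] at hne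
      have hq : (⟨p, hp⟩ : S) ∈ tsupport (g i) := subset_tsupport _ hne
      obtain ⟨x, hx, hxq⟩ := hsub _ hq
      refine ⟨x, ⟨⟨p, hp⟩, hq, ?_⟩, hxq⟩
      simp only at hxq ⊢
      rw [← hxq, hinv x hx]
  · have := g.sum_eq_one (mem_univ (⟨p, hp⟩ : S))
    rw [finsum_eq_sum_of_fintype] at this
    rw [← this]
    exact Finset.sum_congr rfl fun i _ => hρ i p hp

end Action

/-! ### Critical submanifolds -/

section Critical

variable {n : ℕ} [NeZero n] {Y : Type*} [TopologicalSpace Y]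
  [ChartedSpace (EuclideanHalfSpace (n + 1)) Y] {r : ℕ}

/-- The action of the image of `L` under a diffeomorphism `Φ` that is supported in `K` and moves
one graph of a cover of `L` to a graph, while the other graphs of the cover avoid `K`. -/
theorem hasAction_map [IsManifold (𝓡∂ (n + 1)) ∞ Y] (lam : Lagrangian n Y r)
    {L : OrientedSet n Y} (hL : IsOrientation L) {κ : Type*} [Fintype κ]
    {e : Option κ → OpenPartialHomeomorph Y (EuclideanHalfSpace (n + 1))}
    {f : Option κ → E n → ℝ} {Ω : Option κ → Set (E n)} {ρ : Option κ → Y → ℝ}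
    (hgr : ∀ i, IsGraphOn L.carrier (e i) (f i) (Ω i))
    (hcont : ∀ i, ContinuousOn (ρ i) L.carrier)
    (hcpt : ∀ i, ∃ C : Set (E n), IsCompact C ∧ C ⊆ Ω i ∧
      ∀ p ∈ L.carrier, ρ i p ≠ 0 → p ∈ graphPt (e i) (f i) '' C)
    (hsum : ∀ p ∈ L.carrier, ∑ i, ρ i p = 1) {K : Set Y}
    (hoff : ∀ i : κ, ∀ x ∈ Ω (some i), graphPt (e (some i)) (f (some i)) x ∉ K)
    (Φ : Diffeomorph (𝓡∂ (n + 1)) (𝓡∂ (n + 1)) Y Y ∞) (hΦK : ∀ p ∉ K, Φ p = p)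
    {f' : E n → ℝ} (hf' : ContDiffOn ℝ ∞ f' (Ω none))
    (hf't : ∀ x ∈ Ω none, withLast x (f' x) ∈ ((e none).extend (𝓡∂ (n + 1))).target)
    (hΦf : ∀ x ∈ Ω none, Φ (graphPt (e none) (f none) x) = graphPt (e none) f' x) :
    HasAction lam (L.map Φ)
      ((∫ x in Ω none, ρ none (graphPt (e none) (f none) x)
          * ((L.sign (e none) (graphPt (e none) (f none) x) : ℤ) : ℝ)
          * lam.coeff (e none) (jet r f' x))
        + ∑ i : κ, ∫ x in Ω (some i), ρ (some i) (graphPt (e (some i)) (f (some i)) x)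
          * ((L.sign (e (some i)) (graphPt (e (some i)) (f (some i)) x) : ℤ) : ℝ)
          * lam.coeff (e (some i)) (jet r (f (some i)) x)) := by
  let F : Option κ → E n → ℝ := fun i => i.elim f' fun i => f (some i)
  have hΦg : ∀ i, ∀ x ∈ Ω i, Φ (graphPt (e i) (f i) x) = graphPt (e i) (F i) x := by
    rintro (_ | i) x hx
    · exact hΦf x hx
    · exact hΦK _ (hoff i x hx)
  have hΦg' : ∀ i, ∀ x ∈ Ω i, Φ.symm (graphPt (e i) (F i) x) = graphPt (e i) (f i) x := by
    intro i x hx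
    rw [← hΦg i x hx, Φ.symm_apply_apply]
  -- the graphs that cover the image of `L`
  have hG : ∀ i, IsGraphOn (Φ '' L.carrier) (e i) (F i) (Ω i) := by
    intro i
    obtain ⟨V, hV, himg⟩ := (hgr i).isOpen_image
    refine ⟨(hgr i).chart_mem, (hgr i).isOpen_domain, ?_, ?_, Φ '' V, ?_, ?_⟩
    · cases i with
      | none => exact hf'
      | some i => exact (hgr (some i)).smooth
    · cases i with
      | none => exact hf't
      | some i => exact (hgr (some i)).mem_target
    · exact Φ.toHomeomorph.isOpenMap V hV
    · have hinter : Φ '' (L.carrier ∩ V) = Φ '' L.carrier ∩ Φ '' V := image_inter Φ.injective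
      rw [← hinter, ← himg, image_image]
      exact image_congr fun x hx => (hΦg i x hx).symm
  have hsign : ∀ i, ∀ x ∈ Ω i, (L.map Φ).sign (e i) (graphPt (e i) (F i) x)
      = L.sign (e i) (graphPt (e i) (f i) x) := by
    intro i x hx
    change L.sign (Φ.toHomeomorph.toOpenPartialHomeomorph.trans (e i))
      (Φ.symm (graphPt (e i) (F i) x)) = _
    rw [hΦg' i x hx]
    refine hL.sign_eq (hgr i) (hG i).of_image (fun z hz => ?_) hx (hΦg' i x hx).symm
    change (e i).extend (𝓡∂ (n + 1)) (Φ (graphPt (e i) (f i) z)) = _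
    rw [hΦg i z hz, (hG i).extend_graphPt hz]
  have key := hasAction_of_fintype lam (L.map Φ) e F Ω (fun i p => ρ i (Φ.symm p)) hG
    (fun i => ?_) (fun i => ?_) ?_
  · convert key using 1
    rw [Fintype.sum_option]
    congr 1
    · refine setIntegral_congr_fun ?_ fun x hx => ?_
      · obtain ⟨O, hO, hΩ⟩ := (hgr none).isOpen_domain
        rw [hΩ]
        exact hO.measurableSet.inter isClosed_halfSpace.measurableSet
      · simp only [hsign none x hx, hΦg' none x hx]
        rfl
    · refine Finset.sum_congr rfl fun i _ => setIntegral_congr_fun ?_ fun x hx => ?_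
      · obtain ⟨O, hO, hΩ⟩ := (hgr (some i)).isOpen_domain
        rw [hΩ]
        exact hO.measurableSet.inter isClosed_halfSpace.measurableSet
      · simp only [hsign (some i) x hx, hΦg' (some i) x hx]
        rfl
  · refine (hcont i).comp Φ.symm.continuous.continuousOn ?_
    rintro _ ⟨q, hq, rfl⟩
    rwa [Φ.symm_apply_apply]
  · obtain ⟨C, hC, hCΩ, hCρ⟩ := hcpt i
    refine ⟨C, hC, hCΩ, ?_⟩
    rintro _ ⟨q, hq, rfl⟩ hne
    rw [Φ.symm_apply_apply] at hne
    obtain ⟨x, hx, rfl⟩ := hCρ q hq hne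
    exact ⟨x, hx, (hΦg i x (hCΩ hx)).symm⟩
  · rintro _ ⟨q, hq, rfl⟩
    rw [Φ.symm_apply_apply]
    exact hsum q hq

/-- The integrands in the action are continuous on `Ω` and vanish outside of a compact subset. -/
theorem integrableOn_action {L : OrientedSet n Y} (hL : IsOrientation L)
    (lam : Lagrangian n Y r) {e : OpenPartialHomeomorph Y (EuclideanHalfSpace (n + 1))}
    {f : E n → ℝ} {Ω : Set (E n)} (h : IsGraphOn L.carrier e f Ω) {ρ : Y → ℝ}
    (hρ : ContinuousOn ρ L.carrier)
    (hcpt : ∃ C : Set (E n), IsCompact C ∧ C ⊆ Ω ∧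
      ∀ p ∈ L.carrier, ρ p ≠ 0 → p ∈ graphPt e f '' C)
    {f' : E n → ℝ} (hf' : ContDiffOn ℝ ∞ f' Ω)
    (hf't : ∀ x ∈ Ω, withLast x (f' x) ∈ (e.extend (𝓡∂ (n + 1))).target) :
    IntegrableOn (fun x => ρ (graphPt e f x) * ((L.sign e (graphPt e f x) : ℤ) : ℝ)
      * lam.coeff e (jet r f' x)) Ω := by
  obtain ⟨O, hO, hΩ⟩ := h.isOpen_domain
  obtain ⟨C, hC, hCΩ, hCρ⟩ := hcpt
  have hmeas : MeasurableSet Ω := by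
    rw [hΩ]
    exact hO.measurableSet.inter isClosed_halfSpace.measurableSet
  have h1 : ContinuousOn (fun x => ρ (graphPt e f x)) Ω :=
    hρ.comp h.continuousOn_graphPt fun x hx => h.graphPt_mem hx
  have h2 : ContinuousOn (fun x => ((L.sign e (graphPt e f x) : ℤ) : ℝ)) Ω := by
    intro x hx
    refine (continuousWithinAt_const
      (b := ((L.sign e (graphPt e f x) : ℤ) : ℝ))).congr_of_eventuallyEq ?_ rfl
    filter_upwards [hL.locally_constant e f Ω h x hx] with z hz
    rw [hz]
  have h3 : ContinuousOn (fun x => lam.coeff e (jet r f' x)) Ω := by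
    refine (lam.smooth e h.chart_mem).continuousOn.comp ?_ fun x hx =>
      jet_mem_jetDomain.2 (hf't x hx)
    rw [hΩ] at hf' ⊢
    exact (contDiffOn_jet hO hf').continuousOn
  refine IntegrableOn.of_forall_sdiff_eq_zero
    (((h1.mul h2).mul h3).mono hCΩ |>.integrableOn_compact hC) hmeas fun x hx => ?_
  have : ρ (graphPt e f x) = 0 := by
    by_contra hne
    obtain ⟨z, hz, hzx⟩ := hCρ _ (h.graphPt_mem hx.1) hne
    have hzx' : z = x := by
      have h4 := h.extend_graphPt (hCΩ hz)
      rw [hzx, h.extend_graphPt hx.1] at h4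
      simpa using (congrArg dropLast h4).symm
    exact hx.2 (hzx' ▸ hz)
  simp [this]

/-- A box around a point of a graph, inside of which the graph is the only part of `S`. -/
theorem exists_box {L : OrientedSet n Y} (hL : IsOrientation L)
    {e : OpenPartialHomeomorph Y (EuclideanHalfSpace (n + 1))}
    {f : E n → ℝ} {Ω : Set (E n)} (h : IsGraphOn L.carrier e f Ω) {x₀ : E n} (hx₀ : x₀ ∈ Ω) :
    ∃ δ > 0, ∃ η > 0,
      (∀ x ∈ Metric.closedBall x₀ δ ∩ halfSpace n, x ∈ Ω ∧ |f x - f x₀| ≤ η ∧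
        L.sign e (graphPt e f x) = L.sign e (graphPt e f x₀)) ∧
      ∀ x ∈ Metric.closedBall x₀ δ ∩ halfSpace n, ∀ u ∈ Metric.closedBall (f x₀) (2 * η),
        withLast x u ∈ (e.extend (𝓡∂ (n + 1))).target ∧
        ((e.extend (𝓡∂ (n + 1))).symm (withLast x u) ∈ L.carrier →
          (e.extend (𝓡∂ (n + 1))).symm (withLast x u) ∈ graphPt e f '' Ω) := by
  obtain ⟨O, hO, hΩ⟩ := h.isOpen_domain
  obtain ⟨V, hV, himg⟩ := h.isOpen_image
  obtain ⟨W, hW, hWt⟩ := extend_target_eq e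
  set z₀ := withLast x₀ (f x₀) with hz₀
  have hz₀t : z₀ ∈ (e.extend (𝓡∂ (n + 1))).target := h.mem_target x₀ hx₀
  have hz₀W : z₀ ∈ W := (hWt ▸ hz₀t : z₀ ∈ W ∩ _).1
  have hz₀V : (e.extend (𝓡∂ (n + 1))).symm z₀ ∈ V := by
    have : graphPt e f x₀ ∈ L.carrier ∩ V := himg ▸ mem_image_of_mem _ hx₀
    exact this.2
  have h1 : ∀ᶠ z in 𝓝 z₀, z ∈ (e.extend (𝓡∂ (n + 1))).target →
      (e.extend (𝓡∂ (n + 1))).symm z ∈ V :=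
    eventually_nhdsWithin_iff.1
      ((e.continuousOn_extend_symm (I := 𝓡∂ (n + 1)) z₀ hz₀t).eventually_mem (hV.mem_nhds hz₀V))
  have h2 : ∀ᶠ q : E n × ℝ in 𝓝 (x₀, f x₀), withLast q.1 q.2 ∈ W ∧
      (withLast q.1 q.2 ∈ (e.extend (𝓡∂ (n + 1))).target →
        (e.extend (𝓡∂ (n + 1))).symm (withLast q.1 q.2) ∈ V) :=
    Tendsto.eventually (f := fun q : E n × ℝ => withLast q.1 q.2)
      ((withLastL n).continuous.tendsto (x₀, f x₀)) ((hW.eventually_mem hz₀W).and h1)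
  obtain ⟨ε, hε, hball⟩ := Metric.eventually_nhds_iff.1 h2
  have h3 : ∀ᶠ x in 𝓝[Ω] x₀, |f x - f x₀| < ε / 3 :=
    (h.smooth.continuousOn x₀ hx₀).eventually (Metric.ball_mem_nhds _ (by positivity))
  have h4 := h3.and (hL.locally_constant e f Ω h x₀ hx₀)
  rw [hΩ, inter_comm, nhdsWithin_inter_of_mem' (mem_nhdsWithin_of_mem_nhds
    (hO.mem_nhds (hΩ ▸ hx₀ : x₀ ∈ O ∩ _).1)), eventually_nhdsWithin_iff] at h4
  obtain ⟨ε', hε', hball'⟩ := Metric.eventually_nhds_iff.1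
    (h4.and (hO.eventually_mem (hΩ ▸ hx₀ : x₀ ∈ O ∩ _).1))
  refine ⟨min (ε / 2) (ε' / 2), by positivity, ε / 3, by positivity, fun x hx => ?_,
    fun x hx u hu => ?_⟩
  · have hd : dist x x₀ < ε' := lt_of_le_of_lt (hx.1.trans (min_le_right _ _)) (by linarith)
    obtain ⟨h5, h6⟩ := hball' hd
    obtain ⟨h7, h8⟩ := h5 hx.2
    exact ⟨hΩ ▸ ⟨h6, hx.2⟩, h7.le, h8⟩
  · have hd : dist (x, u) (x₀, f x₀) < ε := by
      rw [Prod.dist_eq]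
      refine max_lt (lt_of_le_of_lt (hx.1.trans (min_le_left _ _)) (by linarith))
        (lt_of_le_of_lt hu (by linarith))
    obtain ⟨h5, h6⟩ := hball hd
    have h7 : withLast x u ∈ (e.extend (𝓡∂ (n + 1))).target := by
      rw [hWt]
      exact ⟨h5, by rw [mem_ofPred_eq, withLast_zero]; exact hx.2⟩
    exact ⟨h7, fun hmem => himg ▸ ⟨hmem, h6 h7⟩⟩

end Critical

section Critical

variable {n : ℕ} [NeZero n] {Y : Type*} [TopologicalSpace Y]
  [ChartedSpace (EuclideanHalfSpace (n + 1)) Y] {r : ℕ}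

/-- Near each of its points, a graph in `L` can be varied vertically by a function `φ` with small
support: a family of diffeomorphisms of `Y`, supported in a set `K` that meets `L` in this graph
only, moves the graph of `f` to the graphs of `f + (ε sin t) φ`. -/
theorem exists_graph_variation [T2Space Y] {L : OrientedSet n Y} (hL : IsOrientation L)
    {e : OpenPartialHomeomorph Y (EuclideanHalfSpace (n + 1))} {f : E n → ℝ} {Ω : Set (E n)}
    (h : IsGraphOn L.carrier e f Ω) {x₀ : E n} (hx₀ : x₀ ∈ Ω) :
    ∃ U : Set (E n), IsOpen U ∧ x₀ ∈ U ∧ (∀ x ∈ U ∩ halfSpace n, x ∈ Ω ∧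
        L.sign e (graphPt e f x) = L.sign e (graphPt e f x₀)) ∧
      ∀ φ : E n → ℝ, ContDiff ℝ ∞ φ → HasCompactSupport φ → tsupport φ ⊆ U →
        ∃ ε : ℝ, 0 < ε ∧ ∃ K : Set Y, IsClosed K ∧ L.carrier ∩ K ⊆ graphPt e f '' Ω ∧
          (∀ x ∈ tsupport φ ∩ halfSpace n, graphPt e f x ∈ K) ∧
          ∃ Φ : ℝ → Diffeomorph (𝓡∂ (n + 1)) (𝓡∂ (n + 1)) Y Y ∞,
            ContMDiff (𝓘(ℝ, ℝ).prod (𝓡∂ (n + 1))) (𝓡∂ (n + 1)) ∞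
              (fun q : ℝ × Y => Φ q.1 q.2) ∧
            (∀ p, Φ 0 p = p) ∧ (∀ t, ∀ p ∉ K, Φ t p = p) ∧
            ∀ t, ∀ x ∈ Ω, withLast x (f x + ε * Real.sin t * φ x)
                ∈ (e.extend (𝓡∂ (n + 1))).target ∧
              Φ t (graphPt e f x) = graphPt e (fun z => f z + ε * Real.sin t * φ z) x := by
  obtain ⟨δ, hδ, η, hη, hbox₁, hbox₂⟩ := exists_box hL h hx₀
  refine ⟨Metric.ball x₀ δ, Metric.isOpen_ball, Metric.mem_ball_self hδ, fun x hx => ?_,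
    fun φ hφ hφc hφU => ?_⟩
  · have := hbox₁ x ⟨Metric.ball_subset_closedBall hx.1, hx.2⟩
    exact ⟨this.1, this.2.2⟩
  -- the displacement is cut off in the vertical direction, away from the graph of `f`
  let b : ContDiffBump (f x₀) := ⟨η, 2 * η, hη, by linarith⟩
  set χ : E (n + 1) → ℝ := fun z => φ (dropLast z) * b (z (Fin.last n)) with hχ
  set C : Set (E (n + 1)) := withLastL n ''
    (Metric.closedBall x₀ δ ×ˢ Metric.closedBall (f x₀) (2 * η)) with hC
  have hCc : IsCompact C := ((isCompact_closedBall _ _).prod (isCompact_closedBall _ _)).image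
    (withLastL n).continuous
  have hχC : tsupport χ ⊆ C := by
    refine closure_minimal (fun z hz => ?_) hCc.isClosed
    have h1 : φ (dropLast z) ≠ 0 := left_ne_zero_of_mul hz
    have h2 : z (Fin.last n) ∈ Function.support b := right_ne_zero_of_mul hz
    rw [b.support_eq] at h2
    exact ⟨(dropLast z, z (Fin.last n)), ⟨Metric.ball_subset_closedBall
      (hφU (subset_tsupport _ h1)), Metric.ball_subset_closedBall h2⟩, withLast_dropLast z⟩
  have hCH : ∀ z ∈ C ∩ {z | 0 ≤ z 0}, ∃ x ∈ Metric.closedBall x₀ δ ∩ halfSpace n,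
      ∃ u ∈ Metric.closedBall (f x₀) (2 * η), withLast x u = z := by
    rintro _ ⟨⟨⟨x, u⟩, ⟨hx, hu⟩, rfl⟩, hz⟩
    rw [mem_ofPred_eq, withLastL_apply, withLast_zero] at hz
    exact ⟨x, ⟨hx, hz⟩, u, hu, rfl⟩
  have hCt : C ∩ {z | 0 ≤ z 0} ⊆ (e.extend (𝓡∂ (n + 1))).target := by
    intro z hz
    obtain ⟨x, hx, u, hu, rfl⟩ := hCH z hz
    exact (hbox₂ x hx u hu).1
  have hχs : ContDiff ℝ ∞ χ := by
    refine (hφ.comp (dropLastL n).contDiff).mul (b.contDiff.comp ?_)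
    fun_prop
  obtain ⟨ε, hε, Φ, hΦs, hΦ0, hΦoff, hΦ⟩ := exists_vertical_family h.chart_mem hχs
    (hCc.of_isClosed_subset (isClosed_tsupport _) hχC)
    ((inter_subset_inter_left _ hχC).trans hCt)
  have hφχ : ∀ x ∈ Ω, χ (withLast x (f x)) = φ x := by
    intro x hx
    simp only [hχ, dropLast_withLast, withLast_last]
    by_cases h1 : φ x = 0
    · rw [h1, zero_mul]
    · have h2 := (hbox₁ x ⟨Metric.ball_subset_closedBall (hφU (subset_tsupport _ h1)),
        h.subset_halfSpace hx⟩).2.1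
      rw [b.one_of_mem_closedBall (by rwa [Metric.mem_closedBall, Real.dist_eq]), mul_one]
  refine ⟨ε, hε, (e.extend (𝓡∂ (n + 1))).symm '' (C ∩ {z | 0 ≤ z 0}),
    (isCompact_image_extend_symm e
      (hCc.inter_right (isClosed_le continuous_const (by fun_prop))) hCt).isClosed,
    ?_, fun x hx => ?_, Φ, hΦs, hΦ0, fun t p hp => ?_, fun t x hx => ?_⟩
  · rintro _ ⟨hp, z, hz, rfl⟩
    obtain ⟨x, hx, u, hu, rfl⟩ := hCH z hz
    exact (hbox₂ x hx u hu).2 hp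
  · have hxδ : x ∈ Metric.closedBall x₀ δ := Metric.ball_subset_closedBall (hφU hx.1)
    refine ⟨withLast x (f x), ⟨⟨(x, f x), ⟨hxδ, ?_⟩, rfl⟩, ?_⟩, rfl⟩
    · rw [Metric.mem_closedBall, Real.dist_eq]
      linarith [(hbox₁ x ⟨hxδ, hx.2⟩).2.1]
    · rw [mem_ofPred_eq, withLast_zero]
      exact hx.2
  · exact hΦoff t p fun hp' => hp (image_mono (inter_subset_inter_left _ hχC) hp')
  · have h1 := hΦ t x (f x) (h.mem_target x hx)
    rw [hφχ x hx] at h1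
    exact h1

/-- The first variation of the action of a critical submanifold vanishes, in a graph chart and for
variations with small support. -/
theorem first_variation_eq_zero [T2Space Y] [IsManifold (𝓡∂ (n + 1)) ∞ Y] {lam : Lagrangian n Y r}
    {L : OrientedSet n Y} (hL : IsAdmissible L) (hcrit : IsCritical lam L)
    {e : OpenPartialHomeomorph Y (EuclideanHalfSpace (n + 1))} {f : E n → ℝ} {Ω : Set (E n)}
    (h : IsGraphOn L.carrier e f Ω) {x₀ : E n} (hx₀ : x₀ ∈ Ω) :
    ∃ U : Set (E n), IsOpen U ∧ x₀ ∈ U ∧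
      ∀ φ : E n → ℝ, ContDiff ℝ ∞ φ → HasCompactSupport φ → tsupport φ ⊆ U →
        ∑ I, ∫ x in halfSpace n, dCoeff lam e I (jet r f x) * iterD I.entries φ x = 0 := by
  obtain ⟨U, hU, hx₀U, hUΩ, hvar⟩ := exists_graph_variation hL.isOrientation h hx₀
  refine ⟨U, hU, hx₀U, fun φ hφ hφc hφU => ?_⟩
  obtain ⟨ε, hε, K, hK, hKL, hφK, Φ, hΦs, hΦ0, hΦoff, hΦ⟩ := hvar φ hφ hφc hφU
  obtain ⟨κ, _, e', f', Ω', ρ, rfl, rfl, rfl, hgr, hcont, hcpt, hsum, hoff⟩ :=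
    exists_partition hL.isCompact hL.isSubmanifold h hK hKL
  set e := e' none
  set f := f' none
  set Ω := Ω' none
  obtain ⟨O, hO, hΩ⟩ := h.isOpen_domain
  have hfs : ContDiffOn ℝ ∞ f (O ∩ halfSpace n) := hΩ ▸ h.smooth
  have hΩm : MeasurableSet Ω := by
    rw [hΩ]
    exact hO.measurableSet.inter isClosed_halfSpace.measurableSet
  set K₁ : Set (E n) := tsupport φ ∩ halfSpace n with hK₁
  have hK₁c : IsCompact K₁ := hφc.isCompact.inter_right isClosed_halfSpace
  have hK₁Ω : K₁ ⊆ Ω := fun x hx => (hUΩ x ⟨hφU hx.1, hx.2⟩).1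
  have hK₁O : K₁ ⊆ O ∩ halfSpace n := hΩ ▸ hK₁Ω
  set w : E n → ℝ := fun x =>
    ρ none (graphPt e f x) * ((L.sign e (graphPt e f x) : ℤ) : ℝ) with hw
  set σ : ℝ := ((L.sign e (graphPt e f x₀) : ℤ) : ℝ) with hσ
  have hσ0 : σ ≠ 0 := by
    rw [hσ]
    exact_mod_cast (L.sign e (graphPt e f x₀)).ne_zero
  -- the other graphs do not meet `K`, so the weight of this graph is `σ` where it is varied
  have hwσ : ∀ x ∈ K₁, w x = σ := by
    intro x hx
    have hxL : graphPt e f x ∈ L.carrier := h.graphPt_mem (hK₁Ω hx)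
    have h1 : ∀ i : κ, ρ (some i) (graphPt e f x) = 0 := by
      intro i
      by_contra hne
      obtain ⟨C, _, hCΩ, hCρ⟩ := hcpt (some i)
      obtain ⟨z, hz, hzx⟩ := hCρ _ hxL hne
      exact hoff i z (hCΩ hz) (hzx ▸ hφK x hx)
    have h2 := hsum _ hxL
    rw [Fintype.sum_option, Finset.sum_eq_zero fun i _ => h1 i, add_zero] at h2
    simp only [hw, h2, one_mul, (hUΩ x ⟨hφU hx.1, hx.2⟩).2, hσ]
  set g : ℝ → E n → ℝ := fun s z => f z + s * φ z with hg
  have hgs : ∀ s, ContDiffOn ℝ ∞ (g s) Ω := fun s =>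
    h.smooth.add (contDiffOn_const.mul hφ.contDiffOn)
  have hjet : ∀ s, ∀ x ∈ Ω \ K₁, jet r (g s) x = jet r f x := by
    intro s x hx
    have hxO : x ∈ O ∩ halfSpace n := hΩ ▸ hx.1
    have h1 : ∀ I : MultiIndex n r, iterD I.entries φ x = 0 := fun I =>
      image_eq_zero_of_notMem_tsupport fun hmem =>
        hx.2 ⟨tsupport_iterD_subset _ _ hmem, hxO.2⟩
    rw [hg, jet_add_mul hO hfs hφ s hxO]
    refine Prod.ext rfl ?_
    ext I
    simp [h1]
  -- the action of the varied submanifolds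
  set c : ℝ := (∫ x in Ω \ K₁, w x * lam.coeff e (jet r f x))
    + ∑ i : κ, ∫ x in Ω' (some i), ρ (some i) (graphPt (e' (some i)) (f' (some i)) x)
      * ((L.sign (e' (some i)) (graphPt (e' (some i)) (f' (some i)) x) : ℤ) : ℝ)
      * lam.coeff (e' (some i)) (jet r (f' (some i)) x) with hc
  set S : ℝ → ℝ := fun s => ∫ x in K₁, lam.coeff e (jet r (g s) x) with hS
  have hact : ∀ t, HasAction lam (L.map (Φ t)) (σ * S (ε * Real.sin t) + c) := by
    intro t
    have h1 := hasAction_map lam hL.isOrientation hgr hcont hcpt hsum hoff (Φ t) (hΦoff t)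
      (hgs (ε * Real.sin t)) (fun x hx => (hΦ t x hx).1) (fun x hx => (hΦ t x hx).2)
    have h2 := integrableOn_action hL.isOrientation lam h (hcont none) (hcpt none)
      (hgs (ε * Real.sin t)) (fun x hx => (hΦ t x hx).1)
    convert h1 using 1
    rw [hc, ← add_assoc]
    congr 1
    refine Eq.trans ?_ (integral_inter_add_sdiff hK₁c.measurableSet h2)
    rw [inter_eq_self_of_subset_right hK₁Ω, hS, ← integral_const_mul]
    congr 1
    · refine setIntegral_congr_fun hK₁c.measurableSet fun x hx => ?_
      change σ * _ = w x * _
      rw [hwσ x hx]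
    · refine setIntegral_congr_fun (hΩm.diff hK₁c.measurableSet) fun x hx => ?_
      change w x * _ = w x * _
      rw [hjet _ x hx]
  have hmem : ∀ s ∈ Icc (-ε) ε, ∀ x ∈ K₁,
      withLast x (f x + s * φ x) ∈ (e.extend (𝓡∂ (n + 1))).target := by
    intro s hs x hx
    have h1 := (hΦ (Real.arcsin (s / ε)) x (hK₁Ω hx)).1
    rwa [Real.sin_arcsin (by rw [le_div_iff₀ hε]; linarith [hs.1])
      (by rw [div_le_iff₀ hε]; linarith [hs.2]), mul_div_cancel₀ _ hε.ne'] at h1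
  have hder := hasDerivAt_integral_coeff lam h.chart_mem hO hfs hφ hK₁c hK₁O hε hmem
  set D := ∫ x in K₁, ∑ I, dCoeff lam e I (jet r f x) * iterD I.entries φ x with hD
  have hD0 : D = 0 := by
    have h1 : HasDerivAt (fun t => ε * Real.sin t) ε 0 := by
      simpa using (Real.hasDerivAt_sin 0).const_mul ε
    have h2 : HasDerivAt S D (ε * Real.sin 0) := by
      rw [Real.sin_zero, mul_zero]
      exact hder
    have h3 := ((h2.comp (0 : ℝ) h1).const_mul σ).add_const c
    have h4 := h3.unique (hcrit Φ hΦs hΦ0 _ hact)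
    simpa [hσ0, hε.ne'] using h4
  have hint : ∀ I : MultiIndex n r,
      IntegrableOn (fun x => dCoeff lam e I (jet r f x) * iterD I.entries φ x) K₁ := by
    intro I
    refine ContinuousOn.integrableOn_compact hK₁c ?_
    refine ContinuousOn.mul ((contDiffOn_dCoeff lam h.chart_mem I).continuousOn.comp
      ((contDiffOn_jet hO hfs).continuousOn.mono hK₁O)
      fun x hx => jet_mem_jetDomain.2 (h.mem_target x (hK₁Ω hx))) ?_
    exact ((ContDiffOn.iterD hO hφ.contDiffOn I.entries).continuousOn).mono hK₁O
  rw [← hD0, hD, integral_finsetSum _ fun I _ => hint I]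
  refine Finset.sum_congr rfl fun I _ => ?_
  refine setIntegral_eq_of_subset_of_forall_sdiff_eq_zero isClosed_halfSpace.measurableSet
    inter_subset_right fun x hx => ?_
  rw [image_eq_zero_of_notMem_tsupport fun hmem =>
    hx.2 ⟨tsupport_iterD_subset I.entries φ hmem, hx.1⟩, mul_zero]

/-- The Euler–Lagrange equations and the natural boundary conditions in a graph chart of a critical
submanifold. -/
theorem euler_of_isCritical [T2Space Y] [IsManifold (𝓡∂ (n + 1)) ∞ Y] {lam : Lagrangian n Y r}
    {L : OrientedSet n Y} (hL : IsAdmissible L) (hcrit : IsCritical lam L)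
    {e : OpenPartialHomeomorph Y (EuclideanHalfSpace (n + 1))} {f : E n → ℝ} {Ω : Set (E n)}
    (h : IsGraphOn L.carrier e f Ω) {x : E n} (hx : x ∈ Ω) :
    eulerLagrange lam e f x = 0 ∧ (x 0 = 0 → ∀ α < r, boundaryEuler lam e f α x = 0) := by
  obtain ⟨O, hO, rfl⟩ := h.isOpen_domain
  refine euler_of_local_variation (a := fun I z => dCoeff lam e I (jet r f z)) hO (fun I => ?_)
    (fun z hz => first_variation_eq_zero hL hcrit h hz) x hx
  exact (contDiffOn_dCoeff lam h.chart_mem I).comp (contDiffOn_jet hO h.smooth)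
    fun z hz => jet_mem_jetDomain.2 (h.mem_target z hz)

end Critical

end FreeBoundary

end

theorem mainTheorem6 {n : ℕ} [NeZero n] {Y : Type*} [TopologicalSpace Y] [T2Space Y]
    [SecondCountableTopology Y] [ChartedSpace (EuclideanHalfSpace (n + 1)) Y]
    [IsManifold (𝓡∂ (n + 1)) ∞ Y] {r : ℕ} (lam : FreeBoundary.Lagrangian n Y r)
    (L : FreeBoundary.OrientedSet n Y) (hL : FreeBoundary.IsAdmissible L)
    (hcrit : FreeBoundary.IsCritical lam L) :
    (∀ p ∈ L.carrier, FreeBoundary.EulerLagrangeAt lam L.carrier p) ∧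
      (∀ p ∈ L.carrier ∩ (𝓡∂ (n + 1)).boundary Y,
        FreeBoundary.NaturalBoundaryAt lam L.carrier p) := by
  refine ⟨fun p _ e f Ω h x hx _ => (FreeBoundary.euler_of_isCritical hL hcrit h hx).1, ?_⟩
  rintro p hp e f Ω h x hx rfl
  refine (FreeBoundary.euler_of_isCritical hL hcrit h hx).2 ?_
  have h0 := (FreeBoundary.mem_boundary_iff h.chart_mem (h.graphPt_mem_source hx)).1 hp.2
  rwa [h.extend_graphPt hx, FreeBoundary.withLast_zero] at h0
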